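/- **Theorem 1.3.** Let $X=(X,d)$ be a separable, locally compact metric space and $\mu$ a $\sigma$-finite Borel measure on $X$. For a Borel set $Y\subseteq X$ and a Lipschitz map $\pi\colon Y\to\mathbb R^n$, say that a function $f$ on $X$ has differential $D\in(\mathbb R^n)^*$ at $y\in Y$ if $f(x)=f(y)+\langle D,\pi(x)-\pi(y)\rangle+o(d(x,y))$ as $x\to y$, $x\in Y$. The pair $(Y,\pi)$ is a *coordinate patch* if for every Lipschitz $f\colon X\to\mathbb R$ there is $Y_f\subseteq Y$ with $\mu(Y\setminus Y_f)=0$ for which there is a unique measurable function $y\mapsto d^\pi f_y\in(\mathbb R^n)^*$ on $Y_f$ such that $d^\pi f_y$ is a differential of $f$ at $y$ for every $y\in Y_f$. Assume that $X$ admits a differentiable structure, i.e. that $X$ is a countable union of coordinate patches (possibly of different dimensions $n$). Let $k\ge 0$. Write $\mathrm{Lip}_c(X)$, $\mathrm{Lip}_{loc}(X)$ and $B_c(X)$ for the spaces of real-valued functions on $X$ that are, respectively, Lipschitz with compact support, locally Lipschitz, and bounded Borel with compact support. Let $T\colon \mathrm{Lip}_c(X)\times \mathrm{Lip}_{loc}(X)^k\to\mathbb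 R$ be a metric $k$-current of locally finite mass, that is: * $T$ is linear in each argument; * $T(f_i,g_i^1,\dots,g_i^k)\to T(f,g^1,\dots,g^k)$ whenever $f_i\to f$ pointwise with uniformly bounded Lipschitz constants and supports in a common compact set, and, for each $j$, $g_i^j\to g^j$ pointwise with Lipschitz constants uniformly bounded on each compact set; * $T(f,g^1,\dots,g^k)=0$ if some $g^i$ is constant on $\operatorname{supp} f$; * $\|T\|(A)<\infty$ whenever $\overline A$ is compact. Here $\|T\|$ is the mass measure: for open $U$, $\|T\|(U)$ is the supremum of the sums $\sum_{s} T(f_s,g_s^1,\dots,g_s^k)$ over all finite families with $f_s\in \mathrm{Lip}_c(X)$, $\operatorname{supp} f_s\subseteq U$, $\sum_s|f_s|\le 1$ pointwise, and $g^i_s\in\mathrm{Lip}_{loc}(X)$ that are $1$-Lipschitz on $\operatorname{supp} f_s$; and $\|T\|(A)=\inf\{\|T\|(U): U\supseteq A \text{ open}\}$ for arbitrary $A$. Suppose $\|T\|\ll\mu$. Then $T$ has a unique extension to a functional on $B_c(X)\times\mathrm{Lip}_{loc}(X)^k$, linear in each argument and again denoted $T$, such that $T(\beta,g^1,\dots,g^k)=\lim_i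 T(f_i,g^1,\dots,g^k)$ whenever $f_i\in\mathrm{Lip}_c(X)$ have supports in a common compact set and $f_i\to\beta$ in $L^1(\|T\|)$; and this extension is a $k$-precurrent, i.e. for every coordinate patch $\pi\colon Y\to\mathbb R^n$ there is a $k$-vector field $\hat\lambda\colon Y\to\bigwedge^k\mathbb R^n$, integrable with respect to $\mu$ on $Y\cap K$ for every compact $K\subseteq X$, such that for all $\beta\in B_c(X)$ and $g^1,\dots,g^k\in\mathrm{Lip}_{loc}(X)$ the differentials $d^\pi g^i_y$ exist and are unique for $\mu$-a.e. $y\in Y$, the integrand below is $\mu$-integrable on $Y$, and $$T(\chi_Y\beta,g^1,\dots,g^k)=\int_Y\big\langle \beta\,d^\pi g^1\wedge\dots\wedge d^\pi g^k,\hat\lambda\big\rangle\,d\mu .$$ -/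

import Mathlib

open MeasureTheory Set Filter Topology
open scoped NNReal ENNReal

namespace MetricCurrents

noncomputable section

section Functions

variable (X : Type*) [MetricSpace X]

/-- `Lip_c(X)`: the real valued Lipschitz functions on `X` with compact support. -/
def LipC : Submodule ℝ (X → ℝ) where
  carrier := {f | (∃ C : ℝ≥0, LipschitzWith C f) ∧ HasCompactSupport f}
  zero_mem' := ⟨⟨0, LipschitzWith.const 0⟩, HasCompactSupport.zero⟩
  add_mem' := by
    rintro f g ⟨⟨C, hf⟩, hf'⟩ ⟨⟨D, hg⟩, hg'⟩
    exact ⟨⟨C + D, hf.add hg⟩, hf'.add hg'⟩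
  smul_mem' := by
    rintro c f ⟨⟨C, hf⟩, hf'⟩
    exact ⟨⟨_, (lipschitzWith_smul c).comp hf⟩, hf'.comp_left (smul_zero c)⟩

/-- `Lip_loc(X)`: the real valued locally Lipschitz functions on `X`. -/
def LipLoc : Submodule ℝ (X → ℝ) where
  carrier := {f | LocallyLipschitz f}
  zero_mem' := LocallyLipschitz.const 0
  add_mem' := fun hf hg => hf.add hg
  smul_mem' := fun c _ hf => (lipschitzWith_smul c).locallyLipschitz.comp hf

/-- `B_c(X)`: the bounded real valued Borel functions on `X` with compact support. -/
def BorelC [MeasurableSpace X] : Submodule ℝ (X → ℝ) where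
  carrier := {f | Measurable f ∧ (∃ C : ℝ, ∀ x, |f x| ≤ C) ∧ HasCompactSupport f}
  zero_mem' := ⟨measurable_const, ⟨0, fun x => by simp⟩, HasCompactSupport.zero⟩
  add_mem' := by
    rintro f g ⟨hf, ⟨C, hC⟩, hf'⟩ ⟨hg, ⟨D, hD⟩, hg'⟩
    exact ⟨hf.add hg, ⟨C + D, fun x => (abs_add_le _ _).trans (add_le_add (hC x) (hD x))⟩,
      hf'.add hg'⟩
  smul_mem' := by
    rintro c f ⟨hf, ⟨C, hC⟩, hf'⟩
    refine ⟨hf.const_smul c, ⟨|c| * C, fun x => ?_⟩, hf'.comp_left (smul_zero c)⟩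
    simpa [abs_mul] using mul_le_mul_of_nonneg_left (hC x) (abs_nonneg c)

variable {X}

instance : CoeFun (LipC X) (fun _ => X → ℝ) := ⟨fun f => f.1⟩
instance : CoeFun (LipLoc X) (fun _ => X → ℝ) := ⟨fun f => f.1⟩
instance [MeasurableSpace X] : CoeFun (BorelC X) (fun _ => X → ℝ) := ⟨fun f => f.1⟩

/-- Multiplication by the characteristic function of a Borel set, on `B_c(X)`. -/
def BorelC.indicator [MeasurableSpace X] {A : Set X} (hA : MeasurableSet A) :
    BorelC X →ₗ[ℝ] BorelC X where
  toFun β := ⟨A.indicator β, β.2.1.indicator hA, by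
    obtain ⟨C, hC⟩ := β.2.2.1
    refine ⟨C, fun x => le_trans ?_ (hC x)⟩
    by_cases hx : x ∈ A <;> simp [hx], by
    refine β.2.2.2.mono ?_
    intro x hx
    by_cases hxA : x ∈ A <;> simp_all⟩
  map_add' β γ := Subtype.ext (Set.indicator_add A β.1 γ.1)
  map_smul' c β := Subtype.ext (Set.indicator_const_smul A c β.1)

/-- Convergence of sequences in `Lip_c(X)`: pointwise convergence, with uniformly bounded Lipschitz
constants and supports in a common compact set. -/
def LipC.Converges (f : ℕ → LipC X) (f' : LipC X) : Prop :=
  (∀ x, Tendsto (fun i => f i x) atTop (𝓝 (f' x))) ∧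
  (∃ C : ℝ≥0, LipschitzWith C f' ∧ ∀ i, LipschitzWith C (f i)) ∧
  (∃ K : Set X, IsCompact K ∧ tsupport f' ⊆ K ∧ ∀ i, tsupport (f i) ⊆ K)

/-- Convergence of sequences in `Lip_loc(X)`: pointwise convergence, with Lipschitz constants
uniformly bounded on every compact set. -/
def LipLoc.Converges (g : ℕ → LipLoc X) (g' : LipLoc X) : Prop :=
  (∀ x, Tendsto (fun i => g i x) atTop (𝓝 (g' x))) ∧
  ∀ K : Set X, IsCompact K →
    ∃ C : ℝ≥0, LipschitzOnWith C g' K ∧ ∀ i, LipschitzOnWith C (g i) K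

end Functions

section Currents

/-- Functionals `T(f, g¹, …, gᵏ)` on `Lip_c(X) × Lip_loc(X)ᵏ` that are linear in each argument. -/
abbrev FormFunctional (X : Type*) [MetricSpace X] (k : ℕ) :=
  LipC X →ₗ[ℝ] MultilinearMap ℝ (fun _ : Fin k => LipLoc X) ℝ

/-- Functionals `T(β, g¹, …, gᵏ)` on `B_c(X) × Lip_loc(X)ᵏ` that are linear in each argument. -/
abbrev MeasFormFunctional (X : Type*) [MetricSpace X] [MeasurableSpace X] (k : ℕ) :=
  BorelC X →ₗ[ℝ] MultilinearMap ℝ (fun _ : Fin k => LipLoc X) ℝ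

variable {X : Type*} [MetricSpace X] {k : ℕ}

/-- Metric `k`-currents (multilinearity is part of the type `FormFunctional X k`). -/
structure IsMetricCurrent (T : FormFunctional X k) : Prop where
  /-- `T(ωᵢ) → T(ω)` whenever `ωᵢ → ω`. -/
  continuity : ∀ (f : ℕ → LipC X) (f' : LipC X) (g : ℕ → Fin k → LipLoc X) (g' : Fin k → LipLoc X),
    LipC.Converges f f' → (∀ j, LipLoc.Converges (fun i => g i j) (g' j)) →
    Tendsto (fun i => T (f i) (g i)) atTop (𝓝 (T f' g'))
  /-- `T(f, g¹, …, gᵏ) = 0` if some `gⁱ` is constant on the support of `f`. -/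
  locality : ∀ (f : LipC X) (g : Fin k → LipLoc X),
    (∃ i, ∃ c : ℝ, ∀ x ∈ tsupport f, g i x = c) → T f g = 0

/-- The values `T(ω)`, where `ω = ∑ₛ fₛ dgₛ¹ ∧ … ∧ dgₛᵏ` is a finite sum of simple forms, the `fₛ`
being supported in `U`, with `∑ₛ |fₛ| ≤ 1` and such that each `gₛⁱ` is `1`-Lipschitz on the support
of `fₛ`; these `ω` are the forms on `U` of comass at most `1`. -/
def massValues (T : FormFunctional X k) (U : Set X) : Set ℝ :=
  {a | ∃ (m : ℕ) (f : Fin m → LipC X) (g : Fin m → Fin k → LipLoc X),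
    (∀ s, tsupport (f s) ⊆ U) ∧
    (∀ s i, LipschitzOnWith 1 (g s i) (tsupport (f s))) ∧
    (∀ x, ∑ s, |f s x| ≤ 1) ∧
    a = ∑ s, T (f s) (g s)}

/-- The mass `‖T‖(U)` of an open set `U`. -/
def massOpen (T : FormFunctional X k) (U : Set X) : ℝ≥0∞ :=
  ⨆ a ∈ massValues T U, ENNReal.ofReal a

lemma massValues_mono (T : FormFunctional X k) {U V : Set X} (h : U ⊆ V) :
    massValues T U ⊆ massValues T V := by
  rintro a ⟨m, f, g, h1, h2⟩
  exact ⟨m, f, g, fun s => (h1 s).trans h, h2⟩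

lemma massOpen_mono (T : FormFunctional X k) {U V : Set X} (h : U ⊆ V) :
    massOpen T U ≤ massOpen T V :=
  biSup_mono (fun _ ha => massValues_mono T h ha)

lemma zero_mem_massValues (T : FormFunctional X k) (U : Set X) : (0 : ℝ) ∈ massValues T U :=
  ⟨0, Fin.elim0, Fin.elim0, fun s => s.elim0, fun s => s.elim0, by simp, by simp⟩

lemma massOpen_empty (T : FormFunctional X k) : massOpen T ∅ = 0 := by
  refine le_antisymm (iSup₂_le ?_) bot_le
  rintro a ⟨m, f, g, h1, h2, h3, rfl⟩
  have hf : ∀ s, f s = 0 := fun s =>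
    Subtype.ext (tsupport_eq_empty_iff.1 (subset_empty_iff.1 (h1 s)))
  simp [hf]

lemma add_mem_massValues (T : FormFunctional X k) {U V : Set X} (h : Disjoint U V) {a b : ℝ}
    (ha : a ∈ massValues T U) (hb : b ∈ massValues T V) : a + b ∈ massValues T (U ∪ V) := by
  obtain ⟨m, f, g, h1, h2, h3, rfl⟩ := ha
  obtain ⟨m', f', g', h1', h2', h3', rfl⟩ := hb
  refine ⟨m + m', Fin.append f f', Fin.append g g', ?_, ?_, ?_, ?_⟩
  · intro s
    refine Fin.addCases (fun s => ?_) (fun s => ?_) s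
    · simpa using (h1 s).trans subset_union_left
    · simpa using (h1' s).trans subset_union_right
  · intro s
    refine Fin.addCases (fun s => ?_) (fun s => ?_) s
    · simpa using h2 s
    · simpa using h2' s
  · intro x
    rw [Fin.sum_univ_add]
    simp only [Fin.append_left, Fin.append_right]
    by_cases hx : x ∈ U
    · have : ∀ s, f' s x = 0 := fun s =>
        image_eq_zero_of_notMem_tsupport (fun h' => Set.disjoint_left.1 h hx (h1' s h'))
      simpa [this] using h3 x
    · have : ∀ s, f s x = 0 := fun s =>
        image_eq_zero_of_notMem_tsupport (fun h' => hx (h1 s h'))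
      simpa [this] using h3' x
  · simp [Fin.sum_univ_add]

lemma massOpen_add_le (T : FormFunctional X k) {U V : Set X} (h : Disjoint U V) :
    massOpen T U + massOpen T V ≤ massOpen T (U ∪ V) := by
  have key : ∀ (W : Set X) (a : ℝ), a ∈ massValues T W → max a 0 ∈ massValues T W := by
    intro W a ha
    rcases le_total a 0 with h0 | h0
    · simpa [h0] using zero_mem_massValues T W
    · simpa [h0] using ha
  refine ENNReal.biSup_add_biSup_le' ⟨0, zero_mem_massValues T U⟩ ⟨0, zero_mem_massValues T V⟩ ?_
  intro a ha b hb
  have := add_mem_massValues T h (key U a ha) (key V b hb)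
  have h2 : ENNReal.ofReal a + ENNReal.ofReal b = ENNReal.ofReal (max a 0 + max b 0) := by
    rw [ENNReal.ofReal_add (le_max_right _ _) (le_max_right _ _)]
    congr 1
    · rcases le_total a 0 with h0 | h0 <;> simp [h0, ENNReal.ofReal_of_nonpos]
    · rcases le_total b 0 with h0 | h0 <;> simp [h0, ENNReal.ofReal_of_nonpos]
  rw [h2]
  exact le_iSup₂ (f := fun a (_ : a ∈ massValues T (U ∪ V)) => ENNReal.ofReal a) _ this

/-- The product of a function of `Lip_c(X)` with a bounded Lipschitz function. -/
lemma LipC.mul_mem (f : LipC X) {φ : X → ℝ} {C : ℝ≥0} (hφ : LipschitzWith C φ)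
    (hb : ∀ x, |φ x| ≤ 1) : (fun x => φ x * f x) ∈ LipC X := by
  obtain ⟨f, ⟨D, hf⟩, hc⟩ := f
  refine ⟨?_, hc.mul_left⟩
  obtain ⟨M, hM⟩ := hc.exists_bound_of_continuous hf.continuous
  refine ⟨D + M.toNNReal * C, LipschitzWith.of_dist_le_mul fun x y => ?_⟩
  have h1 := hf.dist_le_mul x y
  have h2 := hφ.dist_le_mul x y
  have h3 := (hM y).trans (Real.le_coe_toNNReal M)
  rw [Real.dist_eq] at h1 h2 ⊢
  rw [Real.norm_eq_abs] at h3
  have h4 : φ x * f x - φ y * f y = φ x * (f x - f y) + f y * (φ x - φ y) := by ring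
  show |φ x * f x - φ y * f y| ≤ _
  rw [h4]
  refine (abs_add_le _ _).trans ?_
  rw [abs_mul, abs_mul]
  push_cast
  have h5 : |φ x| * |f x - f y| ≤ 1 * (D * dist x y) :=
    mul_le_mul (hb x) h1 (abs_nonneg _) zero_le_one
  have h6 : |f y| * |φ x - φ y| ≤ M.toNNReal * (C * dist x y) :=
    mul_le_mul h3 h2 (abs_nonneg _) (NNReal.coe_nonneg _)
  linarith

/-- A Lipschitz cut-off function for a compact set covered by two open sets. -/
lemma exists_cutoff {K U V : Set X} (hK : IsCompact K) (hU : IsOpen U) (hV : IsOpen V)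
    (hKUV : K ⊆ U ∪ V) : ∃ (φ : X → ℝ) (C : ℝ≥0), LipschitzWith C φ ∧ (∀ x, 0 ≤ φ x) ∧
      (∀ x, φ x ≤ 1) ∧ K ∩ tsupport φ ⊆ U ∧ K ∩ tsupport (fun x => 1 - φ x) ⊆ V := by
  have hA : IsCompact (K \ V) := hK.diff hV
  have hB : IsCompact (K \ U) := hK.diff hU
  have hAB : Disjoint (K \ V) (K \ U) := by
    rw [Set.disjoint_left]
    rintro x ⟨hx, hxV⟩ ⟨_, hxU⟩
    exact (hKUV hx).elim hxU hxV
  obtain ⟨δ, hδ, hd⟩ := hAB.exists_thickenings hA hB.isClosed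
  have hδ2 : 0 < δ / 2 := half_pos hδ
  set E := Metric.thickening (δ / 2) (K \ V) with hE
  have hlip := lipschitzWith_thickenedIndicator hδ2 E
  have hsub : Metric.thickening (δ / 2) E ⊆ Metric.thickening δ (K \ V) := by
    have := Metric.thickening_thickening_subset (δ / 2) (δ / 2) (K \ V)
    simpa using this
  refine ⟨fun x => (thickenedIndicator hδ2 E x : ℝ), _, hlip, fun x => NNReal.coe_nonneg _,
    fun x => by exact_mod_cast thickenedIndicator_le_one hδ2 E x, ?_, ?_⟩
  · rintro x ⟨hxK, hx⟩
    by_contra hxU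
    have hx2 : x ∈ Metric.thickening δ (K \ U) := Metric.self_subset_thickening hδ _ ⟨hxK, hxU⟩
    obtain ⟨y, hy, hy'⟩ := mem_closure_iff.1 hx _ Metric.isOpen_thickening hx2
    apply hy'
    have : y ∉ Metric.thickening (δ / 2) E := fun h => Set.disjoint_left.1 hd (hsub h) hy
    simp [thickenedIndicator_zero hδ2 E this]
  · rintro x ⟨hxK, hx⟩
    by_contra hxV
    have hx2 : x ∈ E := Metric.self_subset_thickening hδ2 _ ⟨hxK, hxV⟩
    obtain ⟨y, hy, hy'⟩ := mem_closure_iff.1 hx _ Metric.isOpen_thickening hx2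
    apply hy'
    simp [thickenedIndicator_one hδ2 E hy]

lemma massOpen_union_le (T : FormFunctional X k) {U V : Set X} (hU : IsOpen U) (hV : IsOpen V) :
    massOpen T (U ∪ V) ≤ massOpen T U + massOpen T V := by
  refine iSup₂_le ?_
  rintro a ⟨m, f, g, h1, h2, h3, rfl⟩
  have hK : IsCompact (⋃ s, tsupport (f s)) := isCompact_iUnion fun s => (f s).2.2
  obtain ⟨φ, C, hφ, hφ0, hφ1, hφU, hφV⟩ := exists_cutoff hK hU hV (iUnion_subset h1)
  have hψ : LipschitzWith (0 + C) (fun x => 1 - φ x) := (LipschitzWith.const (1 : ℝ)).sub hφ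
  have hφb : ∀ x, |φ x| ≤ 1 := fun x => by rw [abs_of_nonneg (hφ0 x)]; exact hφ1 x
  have hψb : ∀ x, |1 - φ x| ≤ 1 := fun x => by
    rw [abs_of_nonneg (by linarith [hφ1 x])]; linarith [hφ0 x]
  let f1 : Fin m → LipC X := fun s => ⟨_, LipC.mul_mem (f s) hφ hφb⟩
  let f2 : Fin m → LipC X := fun s => ⟨_, LipC.mul_mem (f s) hψ hψb⟩
  have hf : ∀ s, f s = f1 s + f2 s := fun s => by
    ext x
    simp [f1, f2]
    ring
  have hs1 : ∀ s, tsupport (f1 s) ⊆ tsupport φ ∩ tsupport (f s) := fun s =>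
    subset_inter tsupport_mul_subset_left tsupport_mul_subset_right
  have hs2 : ∀ s, tsupport (f2 s) ⊆ tsupport (fun x => 1 - φ x) ∩ tsupport (f s) := fun s =>
    subset_inter tsupport_mul_subset_left tsupport_mul_subset_right
  have m1 : ∑ s, T (f1 s) (g s) ∈ massValues T U := by
    refine ⟨m, f1, g, fun s x hx => hφU ⟨mem_iUnion_of_mem s (hs1 s hx).2, (hs1 s hx).1⟩,
      fun s i => (h2 s i).mono fun x hx => (hs1 s hx).2, fun x => ?_, rfl⟩
    refine (Finset.sum_le_sum fun s _ => ?_).trans (h3 x)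
    simpa [f1, abs_mul] using mul_le_mul_of_nonneg_right (hφb x) (abs_nonneg (f s x))
  have m2 : ∑ s, T (f2 s) (g s) ∈ massValues T V := by
    refine ⟨m, f2, g, fun s x hx => hφV ⟨mem_iUnion_of_mem s (hs2 s hx).2, (hs2 s hx).1⟩,
      fun s i => (h2 s i).mono fun x hx => (hs2 s hx).2, fun x => ?_, rfl⟩
    refine (Finset.sum_le_sum fun s _ => ?_).trans (h3 x)
    simpa [f2, abs_mul] using mul_le_mul_of_nonneg_right (hψb x) (abs_nonneg (f s x))
  have hsum : ∑ s, T (f s) (g s) = ∑ s, T (f1 s) (g s) + ∑ s, T (f2 s) (g s) := by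
    rw [← Finset.sum_add_distrib]
    refine Finset.sum_congr rfl fun s _ => ?_
    rw [hf s, map_add, add_apply]
  rw [hsum]
  refine ENNReal.ofReal_add_le.trans (add_le_add ?_ ?_)
  · exact le_iSup₂ (f := fun a (_ : a ∈ massValues T U) => ENNReal.ofReal a) _ m1
  · exact le_iSup₂ (f := fun a (_ : a ∈ massValues T V) => ENNReal.ofReal a) _ m2

lemma massOpen_biUnion_le (T : FormFunctional X k) {U : ℕ → Set X} (hU : ∀ n, IsOpen (U n))
    (t : Finset ℕ) : massOpen T (⋃ n ∈ t, U n) ≤ ∑ n ∈ t, massOpen T (U n) := by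
  induction t using Finset.induction_on with
  | empty => simp [massOpen_empty]
  | insert n t hn ih =>
    rw [Finset.set_biUnion_insert, Finset.sum_insert hn]
    exact (massOpen_union_le T (hU n) (isOpen_biUnion fun i _ => hU i)).trans
      (add_le_add le_rfl ih)

lemma massOpen_iUnion_le (T : FormFunctional X k) {U : ℕ → Set X} (hU : ∀ n, IsOpen (U n)) :
    massOpen T (⋃ n, U n) ≤ ∑' n, massOpen T (U n) := by
  refine iSup₂_le ?_
  rintro a ⟨m, f, g, h1, h2, h3, rfl⟩
  have hK : IsCompact (⋃ s, tsupport (f s)) := isCompact_iUnion fun s => (f s).2.2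
  obtain ⟨t, ht⟩ := hK.elim_finite_subcover U hU (iUnion_subset h1)
  refine le_trans ?_ ((massOpen_biUnion_le T hU t).trans (ENNReal.sum_le_tsum t))
  exact le_iSup₂ (f := fun a (_ : a ∈ massValues T (⋃ n ∈ t, U n)) => ENNReal.ofReal a) _
    ⟨m, f, g, fun s => (subset_iUnion (fun s => tsupport (f s)) s).trans ht, h2, h3, rfl⟩

/-- The mass of `T` as an outer measure: `‖T‖(A)` is the infimum of `‖T‖(U)` over the open sets
`U ⊇ A`. -/
def massOuter (T : FormFunctional X k) : OuterMeasure X where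
  measureOf A := ⨅ (U : Set X) (_ : IsOpen U) (_ : A ⊆ U), massOpen T U
  empty := by
    refine le_antisymm ?_ bot_le
    refine (iInf_le_of_le ∅ (iInf_le_of_le isOpen_empty (iInf_le_of_le subset_rfl ?_)))
    exact (massOpen_empty T).le
  mono := fun h => le_iInf fun U => le_iInf fun hU => le_iInf fun hs =>
    iInf_le_of_le U (iInf_le_of_le hU (iInf_le_of_le (h.trans hs) le_rfl))
  iUnion_nat := by
    intro s _
    refine ENNReal.le_of_forall_pos_le_add fun ε hε hfin => ?_
    obtain ⟨ε', hε', hsum⟩ := ENNReal.exists_pos_sum_of_countable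
      (ENNReal.coe_pos.2 hε).ne' ℕ
    have hlt : ∀ n, ∃ U, IsOpen U ∧ s n ⊆ U ∧ massOpen T U ≤
        (⨅ (U : Set X) (_ : IsOpen U) (_ : s n ⊆ U), massOpen T U) + ε' n := by
      intro n
      have hne := ne_top_of_le_ne_top hfin.ne (ENNReal.le_tsum n)
      have := ENNReal.lt_add_right hne (ENNReal.coe_pos.2 (hε' n)).ne'
      obtain ⟨U, hU⟩ := iInf_lt_iff.1 this
      obtain ⟨hUo, hU⟩ := iInf_lt_iff.1 hU
      obtain ⟨hsU, hU⟩ := iInf_lt_iff.1 hU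
      exact ⟨U, hUo, hsU, hU.le⟩
    choose U hUo hsU hU using hlt
    calc (⨅ (V : Set X) (_ : IsOpen V) (_ : (⋃ n, s n) ⊆ V), massOpen T V)
        ≤ massOpen T (⋃ n, U n) := iInf_le_of_le _ (iInf_le_of_le (isOpen_iUnion hUo)
          (iInf_le_of_le (iUnion_mono hsU) le_rfl))
      _ ≤ ∑' n, massOpen T (U n) := massOpen_iUnion_le T hUo
      _ ≤ ∑' n, ((⨅ (V : Set X) (_ : IsOpen V) (_ : s n ⊆ V), massOpen T V) + ε' n) :=
          ENNReal.tsum_le_tsum hU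
      _ ≤ _ := by
          rw [ENNReal.tsum_add]
          exact add_le_add le_rfl hsum.le

lemma massOuter_isMetric (T : FormFunctional X k) : (massOuter T).IsMetric := by
  rintro s t ⟨r, hr, hst⟩
  refine le_antisymm (measure_union_le s t) ?_
  refine le_iInf fun W => le_iInf fun hW => le_iInf fun hsub => ?_
  have hr2 : r / 2 ≠ 0 := by simpa using hr
  let U := W ∩ ⋃ x ∈ s, Metric.eball x (r / 2)
  let V := W ∩ ⋃ x ∈ t, Metric.eball x (r / 2)
  have hU : IsOpen U := hW.inter (isOpen_biUnion fun _ _ => Metric.isOpen_eball)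
  have hV : IsOpen V := hW.inter (isOpen_biUnion fun _ _ => Metric.isOpen_eball)
  have hsU : s ⊆ U := fun x hx => ⟨hsub (Or.inl hx),
    mem_biUnion hx (Metric.mem_eball_self (pos_iff_ne_zero.2 hr2))⟩
  have htV : t ⊆ V := fun x hx => ⟨hsub (Or.inr hx),
    mem_biUnion hx (Metric.mem_eball_self (pos_iff_ne_zero.2 hr2))⟩
  have hd : Disjoint U V := by
    rw [Set.disjoint_left]
    rintro z ⟨_, hz⟩ ⟨_, hz'⟩
    obtain ⟨x, hx, hzx⟩ := mem_iUnion₂.1 hz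
    obtain ⟨y, hy, hzy⟩ := mem_iUnion₂.1 hz'
    have h1 : edist x y ≤ edist z x + edist z y := by
      rw [edist_comm z x]; exact edist_triangle x z y
    have h2 : edist z x + edist z y < r / 2 + r / 2 := ENNReal.add_lt_add hzx hzy
    rw [ENNReal.add_halves] at h2
    exact absurd (h1.trans_lt h2) (not_lt.2 (hst x hx y hy))
  calc massOuter T s + massOuter T t ≤ massOpen T U + massOpen T V :=
        add_le_add (iInf_le_of_le U (iInf_le_of_le hU (iInf_le_of_le hsU le_rfl)))
          (iInf_le_of_le V (iInf_le_of_le hV (iInf_le_of_le htV le_rfl)))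
    _ ≤ massOpen T (U ∪ V) := massOpen_add_le T hd
    _ ≤ massOpen T W := massOpen_mono T (union_subset inter_subset_left inter_subset_left)

variable [MeasurableSpace X] [BorelSpace X]

/-- The mass `‖T‖`, as a Borel measure. -/
def mass (T : FormFunctional X k) : Measure X :=
  (massOuter T).toMeasure (massOuter_isMetric T).le_caratheodory

/-- `T` has locally finite mass: `‖T‖` is finite on relatively compact sets. -/
def HasLocallyFiniteMass (T : FormFunctional X k) : Prop :=
  ∀ A : Set X, IsCompact (closure A) → mass T A < ∞

/-- `T'` is the canonical extension of `T` to `B_c(X) × Lip_loc(X)ᵏ`: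
`T'(β, g) = lim T(fᵢ, g)` whenever the `fᵢ ∈ Lip_c(X)`, with supports in a common compact set,
converge to `β` in `L¹(‖T‖)`. -/
def IsCanonicalExtension (T : FormFunctional X k) (T' : MeasFormFunctional X k) : Prop :=
  ∀ (β : BorelC X) (f : ℕ → LipC X) (g : Fin k → LipLoc X),
    (∃ K : Set X, IsCompact K ∧ ∀ i, tsupport (f i) ⊆ K) →
    Tendsto (fun i => ∫⁻ x, ENNReal.ofReal |f i x - β x| ∂(mass T)) atTop (𝓝 0) →
    Tendsto (fun i => T (f i) g) atTop (𝓝 (T' β g))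

/-- The restriction `T ⌊ A` to a Borel set: `(T ⌊ A)(β, g) = T(χ_A β, g)`. -/
def MeasFormFunctional.restrict (T : MeasFormFunctional X k) {A : Set X} (hA : MeasurableSet A) :
    MeasFormFunctional X k :=
  T ∘ₗ BorelC.indicator hA

end Currents

section Charts

variable {X : Type*} [MetricSpace X]

/-- `D` is a differential at `y` of `f`, along `Y`, with respect to `π : Y → ℝⁿ`:
`f(x) = f(y) + ⟨D, π(x) - π(y)⟩ + o(d(x, y))` as `x → y`, `x ∈ Y`.
(Only the values of `π` on `Y` matter.) -/
def HasChartDiffAt {n : ℕ} (Y : Set X) (π : X → EuclideanSpace ℝ (Fin n)) (f : X → ℝ) (y : X)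
    (D : EuclideanSpace ℝ (Fin n) →L[ℝ] ℝ) : Prop :=
  (fun x => f x - f y - D (π x - π y)) =o[𝓝[Y] y] (fun x => dist x y)

open Classical in
/-- The differential `d^π f_y` where there is exactly one (and `0` elsewhere). -/
def chartDiff {n : ℕ} (Y : Set X) (π : X → EuclideanSpace ℝ (Fin n)) (f : X → ℝ) (y : X) :
    EuclideanSpace ℝ (Fin n) →L[ℝ] ℝ :=
  if h : ∃! D, HasChartDiffAt Y π f y D then h.choose else 0

variable [MeasurableSpace X]

/-- `(Y, π)` is a coordinate patch of the metric measure space `(X, d, μ)`. -/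
structure IsCoordinatePatch (μ : Measure X) {n : ℕ} (Y : Set X)
    (π : X → EuclideanSpace ℝ (Fin n)) : Prop where
  measurableSet : MeasurableSet Y
  lipschitz : ∃ C : ℝ≥0, LipschitzOnWith C π Y
  differentiable : ∀ f : X → ℝ, (∃ C : ℝ≥0, LipschitzWith C f) →
    ∃ Yf ⊆ Y, μ (Y \ Yf) = 0 ∧
      ∃! D : Yf → (EuclideanSpace ℝ (Fin n) →L[ℝ] ℝ),
        Measurable D ∧ ∀ y : Yf, HasChartDiffAt Y π f y (D y)

/-- `(X, d, μ)` admits a (strong measured) differentiable structure: `X` is a countable union of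
coordinate patches, possibly of different dimensions. -/
def AdmitsDifferentiableStructure (μ : Measure X) : Prop :=
  ∃ (n : ℕ → ℕ) (Y : ℕ → Set X) (π : ∀ j, X → EuclideanSpace ℝ (Fin (n j))),
    (∀ j, IsCoordinatePatch μ (Y j) (π j)) ∧ ⋃ j, Y j = univ

/-- The function `y ↦ ⟨d^π g¹_y ∧ … ∧ d^π gᵏ_y, v⟩`, for a `k`-vector `v ∈ ⋀ᵏ ℝⁿ`. -/
def wedgePairing {n k : ℕ} (Y : Set X) (π : X → EuclideanSpace ℝ (Fin n))
    (g : Fin k → LipLoc X) (y : X) (v : ⋀[ℝ]^k (EuclideanSpace ℝ (Fin n))) : ℝ :=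
  exteriorPower.pairingDual ℝ (EuclideanSpace ℝ (Fin n)) k
    (exteriorPower.ιMulti ℝ k fun i =>
      (chartDiff Y π (g i) y : EuclideanSpace ℝ (Fin n) →ₗ[ℝ] ℝ)) v

/-- A `k`-vector field on `Y` is locally integrable if each of its components is: it is integrable
on `Y ∩ K` for every compact set `K` when `X` is locally compact. -/
def LocallyIntegrableField (μ : Measure X) {n k : ℕ} (Y : Set X)
    (v : X → ⋀[ℝ]^k (EuclideanSpace ℝ (Fin n))) : Prop :=
  ∀ ℓ : ⋀[ℝ]^k (EuclideanSpace ℝ (Fin n)) →ₗ[ℝ] ℝ,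
    LocallyIntegrable (fun y => ℓ (v y)) (μ.restrict Y)

/-- `S` is a `k`-precurrent on the chart `(Y, π)`: for a locally integrable `k`-vector field `v` on
`Y`, one has `S(β dg¹ ∧ … ∧ dgᵏ) = ∫_Y ⟨β d^π g¹ ∧ … ∧ d^π gᵏ, v⟩ dμ`, where the differentials exist
almost everywhere on `Y` and the integrand is integrable. -/
def IsPrecurrentOn (μ : Measure X) {n k : ℕ} (Y : Set X) (π : X → EuclideanSpace ℝ (Fin n))
    (S : MeasFormFunctional X k) : Prop :=
  ∃ v : X → ⋀[ℝ]^k (EuclideanSpace ℝ (Fin n)), LocallyIntegrableField μ Y v ∧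
    ∀ (β : BorelC X) (g : Fin k → LipLoc X),
      (∀ᵐ y ∂(μ.restrict Y), ∀ i, ∃! D, HasChartDiffAt Y π (g i) y D) ∧
      IntegrableOn (fun y => β y * wedgePairing Y π g y (v y)) Y μ ∧
      S β g = ∫ y in Y, β y * wedgePairing Y π g y (v y) ∂μ

/-- `S` is a `k`-precurrent: `S ⌊ Y` is a precurrent on `Y` for every coordinate patch `(Y, π)`. -/
def IsPrecurrent [BorelSpace X] (μ : Measure X) {k : ℕ} (S : MeasFormFunctional X k) : Prop :=
  ∀ (n : ℕ) (Y : Set X) (π : X → EuclideanSpace ℝ (Fin n)) (h : IsCoordinatePatch μ Y π),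
    IsPrecurrentOn μ Y π (MeasFormFunctional.restrict S h.measurableSet)

end Charts

end

end MetricCurrents

/-! A current of locally finite mass is controlled by an L¹ norm of its first argument: |T(f, g)| ≤
∏ Lip(gⁱ) ∫ |f| d‖T‖, the Lipschitz constants being taken on the support of f. This is obtained by
slicing f into thin layers (`IsMetricCurrent.abs_apply_le`). Every function of `B_c(X)` is an
L¹(‖T‖) limit of functions of `Lip_c(X)` supported in one compact set, so T extends by continuity,
in exactly one way.

The extension T' is better behaved than T. It is continuous in g, and it is strictly local: it
vanishes as soon as some gⁱ is constant on a set off which β vanishes, without passing to closures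
(`IsCanonicalExtension.apply_eq_zero_of_const`). Hence only the Lipschitz constants of the gⁱ on
such a set matter, and after a countable decomposition only the pointwise Lipschitz constants along
it (`IsCanonicalExtension.abs_apply_le_of_eventually`). Strict locality also makes T' alternating in
g.

For fixed g the mass estimate and ‖T‖ ≪ μ turn β ↦ T'(β, g) into integration against a density
(`exists_density`). The core is a chain rule for these densities. On the part of a chart where the
differential of gⁱ is close to a fixed covector c, the function gⁱ - ∑ cⱼ πʲ has small pointwise
Lipschitz constant, so exchanging gⁱ for ∑ cⱼ πʲ changes the density little; letting c approach the
differential gives `IsCanonicalExtension.density_eq_sum_update`. Applied slot by slot, it expresses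
every density through the densities of tuples of coordinate functions. These are alternating, and
they are the components of the required k-vector field. -/

namespace MetricCurrents

noncomputable section

/-! ### Changing the arguments of a multilinear map one at a time. -/

section Multilinear

/-- If a multilinear map vanishes as soon as one of its arguments satisfies `p`, then it does not
change when its arguments are changed by elements satisfying `p`. -/
lemma multilinearMap_congr_of_sub {ι E F : Type*} [Finite ι] [AddCommGroup E] [Module ℝ E]
    [AddCommGroup F] [Module ℝ F] (M : MultilinearMap ℝ (fun _ : ι => E) F) (p : E → Prop)
    (h0 : ∀ g i, p (g i) → M g = 0) (g g' : ι → E) (h : ∀ i, p (g i - g' i)) : M g = M g' := by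
  classical
  have := Fintype.ofFinite ι
  have key : ∀ s : Finset ι, M (s.piecewise g g') = M g' := by
    intro s
    induction s using Finset.induction_on with
    | empty => simp
    | insert j s hj ih =>
      rw [Finset.piecewise_insert, ← ih, ← sub_eq_zero]
      -- Slot j still holds `g' j`, so the two tuples differ in that slot only, and multilinearity
      -- makes the difference a value with `g j - g' j` there.
      have h1 : s.piecewise g g' = Function.update (s.piecewise g g') j (g' j) := by
        ext i
        by_cases hi : i = j
        · subst hi; simp [hj]
        · simp [hi]
      conv_lhs => rw [h1]
      rw [Function.update_idem, ← M.map_update_sub]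
      exact h0 _ j (by simpa using h j)
  simpa using key Finset.univ

end Multilinear

/-! ### Lipschitz and locally Lipschitz functions: extension and composition. -/

section Lipschitz

variable {X : Type*} [MetricSpace X]

/-- A Lipschitz function, as an element of `Lip_loc(X)`. -/
def LipLoc.ofLipschitz {g : X → ℝ} {C : ℝ≥0} (hg : LipschitzWith C g) : LipLoc X :=
  ⟨g, hg.locallyLipschitz⟩

@[simp]
lemma LipLoc.ofLipschitz_apply {g : X → ℝ} {C : ℝ≥0} (hg : LipschitzWith C g) (x : X) :
    LipLoc.ofLipschitz hg x = g x := rfl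

lemma LipLoc.continuous (g : LipLoc X) : Continuous g := LocallyLipschitz.continuous g.2

lemma LipLoc.exists_lipschitzOnWith (g : LipLoc X) {K : Set X} (hK : IsCompact K) :
    ∃ C : ℝ≥0, LipschitzOnWith C g K :=
  LocallyLipschitzOn.exists_lipschitzOnWith_of_compact hK
    (LocallyLipschitz.locallyLipschitzOn g.2)

lemma LipLoc.exists_extension (g : LipLoc X) {P : Set X} {C : ℝ≥0} (hg : LipschitzOnWith C g P) :
    ∃ g' : LipLoc X, LipschitzWith C g' ∧ EqOn g g' P := by
  obtain ⟨g', h1, h2⟩ := hg.extend_real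
  exact ⟨LipLoc.ofLipschitz h1, h1, h2⟩

/-- The composition of a function of `Lip_loc(X)` with a Lipschitz function. -/
def LipLoc.comp {φ : ℝ → ℝ} {C : ℝ≥0} (hφ : LipschitzWith C φ) (g : LipLoc X) : LipLoc X :=
  ⟨fun x => φ (g x), hφ.locallyLipschitz.comp g.2⟩

@[simp]
lemma LipLoc.comp_apply {φ : ℝ → ℝ} {C : ℝ≥0} (hφ : LipschitzWith C φ) (g : LipLoc X) (x : X) :
    LipLoc.comp hφ g x = φ (g x) := rfl

lemma LipC.continuous (f : LipC X) : Continuous f := f.2.1.choose_spec.continuous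

/-- The composition of a function of `Lip_c(X)` with a Lipschitz function vanishing at `0`. -/
def LipC.comp {φ : ℝ → ℝ} {C : ℝ≥0} (hφ : LipschitzWith C φ) (h0 : φ 0 = 0) (f : LipC X) :
    LipC X :=
  ⟨fun x => φ (f x), ⟨_, hφ.comp f.2.1.choose_spec⟩, f.2.2.comp_left h0⟩

@[simp]
lemma LipC.comp_apply {φ : ℝ → ℝ} {C : ℝ≥0} (hφ : LipschitzWith C φ) (h0 : φ 0 = 0) (f : LipC X)
    (x : X) : LipC.comp hφ h0 f x = φ (f x) := rfl

lemma LipC.tsupport_comp_subset {φ : ℝ → ℝ} {C : ℝ≥0} (hφ : LipschitzWith C φ) (h0 : φ 0 = 0)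
    (f : LipC X) : tsupport (LipC.comp hφ h0 f) ⊆ tsupport f :=
  closure_mono fun x hx hx' => hx (by simp [hx', h0])

end Lipschitz

/-! ### The mass estimate for T. -/

section MassEstimate

variable {X : Type*} [MetricSpace X] {k : ℕ} {T : FormFunctional X k}

lemma IsMetricCurrent.congr_of_eqOn (hT : IsMetricCurrent T) (f : LipC X) (g g' : Fin k → LipLoc X)
    (h : ∀ i, EqOn (g i) (g' i) (tsupport f)) : T f g = T f g' := by
  refine multilinearMap_congr_of_sub (T f) (fun u => ∀ x ∈ tsupport f, u x = 0)
    (fun g i hi => hT.locality f g ⟨i, 0, hi⟩) g g' fun i x hx => ?_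
  have := h i hx
  simpa [sub_eq_zero] using this

lemma mem_massValues_single (f : LipC X) (g : Fin k → LipLoc X) {U : Set X}
    (hU : tsupport f ⊆ U) (hg : ∀ i, LipschitzOnWith 1 (g i) (tsupport f)) (hf : ∀ x, |f x| ≤ 1) :
    T f g ∈ massValues T U :=
  ⟨1, fun _ => f, fun _ => g, fun _ => hU, fun _ => hg, by simpa using hf, by simp⟩

variable [MeasurableSpace X] [BorelSpace X]

lemma ofReal_abs_apply_le_mass (f : LipC X) (g : Fin k → LipLoc X) {A : Set X}
    (hA : tsupport f ⊆ A) (hg : ∀ i, LipschitzOnWith 1 (g i) (tsupport f))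
    (hf : ∀ x, |f x| ≤ 1) : ENNReal.ofReal |T f g| ≤ mass T A := by
  refine le_trans ?_ (le_toMeasure_apply _ _ A)
  refine le_iInf fun U => le_iInf fun hU => le_iInf fun hs => ?_
  have h1 : T f g ∈ massValues T U := mem_massValues_single f g (hA.trans hs) hg hf
  have ht : tsupport (-f : LipC X) = tsupport f := by
    simp [tsupport]
  have h2 : -T f g ∈ massValues T U := by
    have := mem_massValues_single (T := T) (-f) g (U := U) (by rw [ht]; exact hA.trans hs)
      (by rw [ht]; exact hg) (by simpa using hf)
    simpa using this
  rcases abs_choice (T f g) with h | h <;> rw [h]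
  · exact le_iSup₂ (f := fun a (_ : a ∈ massValues T U) => ENNReal.ofReal a) _ h1
  · exact le_iSup₂ (f := fun a (_ : a ∈ massValues T U) => ENNReal.ofReal a) _ h2

/-- The function cutting out the layer between `j` and `j + 1`. -/
def layer (j : ℕ) (t : ℝ) : ℝ := max 0 (min 1 (t - j))

lemma layer_nonneg (j : ℕ) (t : ℝ) : 0 ≤ layer j t := le_max_left _ _

lemma layer_le_one (j : ℕ) (t : ℝ) : layer j t ≤ 1 := max_le zero_le_one (min_le_left _ _)

lemma layer_eq_one {j : ℕ} {t : ℝ} (h : (j : ℝ) + 1 ≤ t) : layer j t = 1 := by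
  rw [layer, min_eq_left (by linarith), max_eq_right zero_le_one]

lemma layer_eq_zero {j : ℕ} {t : ℝ} (h : t ≤ j) : layer j t = 0 :=
  max_eq_left ((min_le_right _ _).trans (by linarith))

lemma sum_layer (m : ℕ) {t : ℝ} (h0 : 0 ≤ t) : ∑ j ∈ Finset.range m, layer j t = min t m := by
  induction m with
  | zero => simp [h0]
  | succ m ih =>
    rw [Finset.sum_range_succ, ih, layer]
    push_cast
    rcases le_total t m with h | h
    · have h1 : max 0 (min 1 (t - m)) = 0 := max_eq_left ((min_le_right _ _).trans (by linarith))
      rw [h1, min_eq_left h, min_eq_left (by linarith), add_zero]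
    · rw [min_eq_right h, max_eq_right (le_min zero_le_one (by linarith))]
      rcases le_total t (m + 1) with h' | h'
      · rw [min_eq_right (by linarith), min_eq_left h']; ring
      · rw [min_eq_left (by linarith), min_eq_right h']

lemma lipschitzWith_layer_mul (N : ℝ≥0) (j : ℕ) : LipschitzWith N fun t : ℝ => layer j (N * t) := by
  have h1 : LipschitzWith N fun t : ℝ => N * t - j := by
    refine LipschitzWith.of_dist_le_mul fun x y => le_of_eq ?_
    rw [Real.dist_eq, Real.dist_eq, show N * x - j - (N * y - j) = N * (x - y) by ring, abs_mul,
      NNReal.abs_eq]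
  exact (h1.const_min 1).const_max 0

variable [IsFiniteMeasureOnCompacts (mass T)]

lemma LipC.integrable (f : LipC X) : Integrable f (mass T) :=
  (LipC.continuous f).integrable_of_hasCompactSupport f.2.2

/-- Layer-cake argument: N f is a sum of layers Fⱼ with values in [0, 1]. The previous layer is 1 on
the support of Fⱼ₊₁, so |T(Fⱼ₊₁, g)| ≤ ‖T‖(supp Fⱼ₊₁) ≤ ∫ Fⱼ. Only the bottom layer lacks a
predecessor; it costs a constant independent of N, which disappears after dividing by N and letting
N → ∞. -/
lemma abs_apply_le_integral_of_nonneg (f : LipC X) (g : Fin k → LipLoc X)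
    (hg : ∀ i, LipschitzOnWith 1 (g i) (tsupport f)) (hf : ∀ x, 0 ≤ f x) :
    |T f g| ≤ ∫ x, f x ∂(mass T) := by
  set S := (mass T).real (tsupport f) with hS
  have hK : IsCompact (tsupport f) := f.2.2
  obtain ⟨B, hB⟩ := f.2.2.exists_bound_of_continuous (LipC.continuous f)
  have key : ∀ N : ℕ, 0 < N → |T f g| ≤ S / N + ∫ x, f x ∂(mass T) := by
    intro N hN
    have hN' : (0 : ℝ) < N := by exact_mod_cast hN
    let F : ℕ → LipC X := fun j =>
      LipC.comp (φ := fun t => layer j ((N : ℝ≥0) * t)) (lipschitzWith_layer_mul N j)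
        (by simpa using layer_eq_zero (Nat.cast_nonneg j)) f
    have hF : ∀ j x, F j x = layer j (N * f x) := fun j x => by simp [F]
    have hFs : ∀ j, tsupport (F j) ⊆ tsupport f := fun j => LipC.tsupport_comp_subset _ _ _
    have hFs' : ∀ j, tsupport (F j) ⊆ {x | (j : ℝ) ≤ N * f x} := fun j => by
      refine closure_minimal (fun x hx => ?_)
        (isClosed_le continuous_const (continuous_const.mul (LipC.continuous f)))
      by_contra h
      exact hx (by rw [hF]; exact layer_eq_zero (not_le.1 h).le)
    have hF0 : ∀ j x, 0 ≤ F j x := fun j x => by rw [hF]; exact layer_nonneg _ _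
    have hF1 : ∀ j x, |F j x| ≤ 1 := fun j x => by
      rw [abs_of_nonneg (hF0 j x), hF]; exact layer_le_one _ _
    -- With m ≥ N B layers the sum min(N f, m) is N f itself.
    obtain ⟨m, hm⟩ := exists_nat_ge (N * B)
    have hsum : ∑ j ∈ Finset.range m, F j = (N : ℝ) • f := by
      ext x
      have h1 : (∑ j ∈ Finset.range m, F j : LipC X) x = ∑ j ∈ Finset.range m, F j x := by
        simp
      rw [h1]
      simp only [hF]
      rw [sum_layer m (mul_nonneg hN'.le (hf x)), min_eq_left]
      · simp
      · refine le_trans (mul_le_mul_of_nonneg_left ?_ hN'.le) hm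
        exact (le_abs_self _).trans (hB x)
    have hT0 : |T (F 0) g| ≤ S := by
      have := ofReal_abs_apply_le_mass (T := T) (F 0) g (hFs 0)
        (fun i => (hg i).mono (hFs 0)) (hF1 0)
      rw [hS, Measure.real, ← ENNReal.ofReal_le_iff_le_toReal hK.measure_lt_top.ne]
      exact this
    have hTs : ∀ j, |T (F (j + 1)) g| ≤ ∫ x, F j x ∂(mass T) := by
      intro j
      have h1 := ofReal_abs_apply_le_mass (T := T) (F (j + 1)) g subset_rfl
        (fun i => (hg i).mono (hFs (j + 1))) (hF1 (j + 1))
      have hfin : mass T (tsupport (F (j + 1))) ≠ ∞ := (F (j + 1)).2.2.isCompact.measure_lt_top.ne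
      rw [ENNReal.ofReal_le_iff_le_toReal hfin] at h1
      refine h1.trans ?_
      have hms : MeasurableSet (tsupport (F (j + 1))) := (isClosed_tsupport _).measurableSet
      rw [← Measure.real, ← integral_indicator_one hms]
      refine integral_mono ((integrable_indicator_iff hms).2 (integrableOn_const hfin))
        (LipC.integrable (F j)) fun x => ?_
      by_cases hx : x ∈ tsupport (F (j + 1))
      · have := hFs' (j + 1) hx
        simp only [mem_ofPred_eq, Nat.cast_add, Nat.cast_one] at this
        rw [indicator_of_mem hx, hF, layer_eq_one this]; simp
      · rw [indicator_of_notMem hx]; exact hF0 j x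
    -- Index shift: layer j + 1 is charged to the integral of layer j, the bottom layer to S, and
    -- the integral of the top layer is left over.
    have hle : ∀ m, ∑ j ∈ Finset.range m, |T (F j) g| ≤ S + ∑ j ∈ Finset.range m, ∫ x, F j x ∂(mass T) := by
      intro m
      cases m with
      | zero => simp [hS]
      | succ m =>
        rw [Finset.sum_range_succ', Finset.sum_range_succ]
        have h1 := Finset.sum_le_sum fun j (_ : j ∈ Finset.range m) => hTs j
        have h2 : 0 ≤ ∫ x, F m x ∂(mass T) := integral_nonneg (hF0 m)
        linarith
    have hint : ∑ j ∈ Finset.range m, ∫ x, F j x ∂(mass T) = N * ∫ x, f x ∂(mass T) := by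
      rw [← integral_finsetSum _ fun j _ => (LipC.integrable (F j)), ← integral_const_mul]
      refine integral_congr_ae (Eventually.of_forall fun x => ?_)
      have := congrArg (fun h : LipC X => h x) hsum
      simpa using this
    have hTN : (N : ℝ) * T f g = ∑ j ∈ Finset.range m, T (F j) g := by
      have := congrArg (fun h : LipC X => T h g) hsum
      simpa [sum_apply] using this.symm
    have : (N : ℝ) * |T f g| ≤ S + N * ∫ x, f x ∂(mass T) := by
      rw [← abs_of_pos hN', ← abs_mul, abs_of_pos hN', hTN, ← hint]
      exact (Finset.abs_sum_le_sum_abs _ _).trans (hle m)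
    rw [← mul_le_mul_iff_right₀ hN']
    refine this.trans (le_of_eq ?_)
    field_simp
  have hlim : Tendsto (fun N : ℕ => S / N + ∫ x, f x ∂(mass T)) atTop
      (𝓝 (0 + ∫ x, f x ∂(mass T))) :=
    (tendsto_const_div_atTop_nhds_zero_nat S).add_const _
  rw [zero_add] at hlim
  exact ge_of_tendsto hlim (eventually_atTop.2 ⟨1, fun N hN => key N hN⟩)

/-- Split f into positive and negative parts; both are Lipschitz with support inside that of f, and
their integrals add up to that of |f|. -/
lemma abs_apply_le_integral_of_one (f : LipC X) (g : Fin k → LipLoc X)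
    (hg : ∀ i, LipschitzOnWith 1 (g i) (tsupport f)) : |T f g| ≤ ∫ x, |f x| ∂(mass T) := by
  have hp : LipschitzWith 1 fun t : ℝ => max t 0 := LipschitzWith.id.max_const 0
  have hn : LipschitzWith 1 fun t : ℝ => max (-t) 0 := LipschitzWith.id.neg.max_const 0
  let fp := LipC.comp hp (by simp) f
  let fn := LipC.comp hn (by simp) f
  have hf : f = fp - fn := by
    ext x
    simp [fp, fn]
  have h1 := abs_apply_le_integral_of_nonneg (T := T) fp g
    (fun i => (hg i).mono (LipC.tsupport_comp_subset _ _ _)) fun x => le_max_right _ _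
  have h2 := abs_apply_le_integral_of_nonneg (T := T) fn g
    (fun i => (hg i).mono (LipC.tsupport_comp_subset _ _ _)) fun x => le_max_right _ _
  have h3 : ∫ x, |f x| ∂(mass T) = ∫ x, fp x ∂(mass T) + ∫ x, fn x ∂(mass T) := by
    rw [← integral_add (LipC.integrable fp) (LipC.integrable fn)]
    refine integral_congr_ae (Eventually.of_forall fun x => ?_)
    simp [fp, fn]
  have h4 : T f g = T fp g - T fn g := by
    conv_lhs => rw [hf]
    simp
  rw [h3, h4]
  exact (abs_sub _ _).trans (add_le_add h1 h2)

/-- The mass estimate for `T`. -/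
lemma IsMetricCurrent.abs_apply_le (hT : IsMetricCurrent T) (f : LipC X) (g : Fin k → LipLoc X)
    {L : Fin k → ℝ≥0} (hg : ∀ i, LipschitzOnWith (L i) (g i) (tsupport f)) :
    |T f g| ≤ (∏ i, (L i : ℝ)) * ∫ x, |f x| ∂(mass T) := by
  have hI : 0 ≤ ∫ x, |f x| ∂(mass T) := integral_nonneg fun x => abs_nonneg _
  -- A vanishing constant prevents the normalization gⁱ / Lᵢ used below; but then gⁱ is constant on
  -- the support and locality applies.
  by_cases h0 : ∃ i, L i = 0
  · obtain ⟨i, hi⟩ := h0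
    have : T f g = 0 := by
      rcases (tsupport f).eq_empty_or_nonempty with he | ⟨x₀, hx₀⟩
      · exact hT.locality f g ⟨i, 0, by simp [he]⟩
      · refine hT.locality f g ⟨i, g i x₀, fun x hx => ?_⟩
        have := (hg i).dist_le_mul x hx x₀ hx₀
        rw [hi] at this
        simpa using this
    rw [this, abs_zero]
    positivity
  · push Not at h0
    have h := abs_apply_le_integral_of_one (T := T) f (fun i => ((L i : ℝ)⁻¹) • g i) fun i => by
      refine LipschitzOnWith.of_dist_le_mul fun x hx y hy => ?_
      have hpos : (0 : ℝ) < L i := by exact_mod_cast pos_iff_ne_zero.2 (h0 i)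
      have := (hg i).dist_le_mul x hx y hy
      rw [Real.dist_eq] at this ⊢
      simp only [Submodule.coe_smul, Pi.smul_apply, smul_eq_mul, ← mul_sub, abs_mul, abs_inv,
        NNReal.abs_eq, NNReal.coe_one, one_mul]
      rwa [inv_mul_le_iff₀ hpos]
    rw [MultilinearMap.map_smul_univ, smul_eq_mul, abs_mul, Finset.prod_inv_distrib, abs_inv,
      Finset.abs_prod] at h
    simp only [NNReal.abs_eq] at h
    have hpos : (0 : ℝ) < ∏ i, (L i : ℝ) :=
      Finset.prod_pos fun i _ => by exact_mod_cast pos_iff_ne_zero.2 (h0 i)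
    rwa [inv_mul_le_iff₀ hpos] at h

end MassEstimate

/-! ### Approximation of bounded Borel functions by Lipschitz functions in L¹. -/

section Approximation

variable {X : Type*} [MetricSpace X]

/-- A bounded uniformly continuous function is a uniform limit of bounded Lipschitz functions. -/
lemma exists_lipschitzWith_abs_sub_le {g : X → ℝ} (hg : UniformContinuous g) {M : ℝ}
    (hM : ∀ x, |g x| ≤ M) {ε : ℝ} (hε : 0 < ε) :
    ∃ (h : X → ℝ) (C : ℝ≥0), LipschitzWith C h ∧ ∀ x, |h x - g x| ≤ ε := by
  rcases isEmpty_or_nonempty X with hX | hX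
  · exact ⟨g, 0, fun x => isEmptyElim x, fun x => isEmptyElim x⟩
  obtain ⟨δ, hδ, hd⟩ := Metric.uniformContinuous_iff.1 hg ε hε
  have hM0 : 0 ≤ M := (abs_nonneg _).trans (hM hX.some)
  -- Slope of the inf-convolution of g with n · dist. Beyond distance δ the penalty is at least 2M,
  -- which exceeds any possible drop of g; within δ uniform continuity limits the drop to ε.
  set n : ℝ≥0 := ⟨2 * M / δ, by positivity⟩ with hn
  have hnv : (n : ℝ) = 2 * M / δ := rfl
  have hbdd : ∀ x, BddBelow (range fun y => g y + n * dist x y) := fun x => by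
    refine ⟨-M, ?_⟩
    rintro _ ⟨y, rfl⟩
    have := (abs_le.1 (hM y)).1
    have h2 : 0 ≤ (n : ℝ) * dist x y := by positivity
    show -M ≤ g y + n * dist x y
    linarith
  refine ⟨fun x => ⨅ y, (g y + n * dist x y), n, ?_, fun x => ?_⟩
  · refine LipschitzWith.of_le_add_mul n fun x y => ?_
    rw [← sub_le_iff_le_add]
    refine le_ciInf fun z => ?_
    rw [sub_le_iff_le_add]
    refine (ciInf_le (hbdd x) z).trans ?_
    have := mul_le_mul_of_nonneg_left (dist_triangle x y z) n.2
    change (n : ℝ) * dist x z ≤ n * _ at this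
    linarith
  · have h1 : (⨅ y, (g y + n * dist x y)) ≤ g x := by
      simpa using ciInf_le (hbdd x) x
    have h2 : g x - ε ≤ ⨅ y, (g y + n * dist x y) := by
      refine le_ciInf fun y => ?_
      rcases lt_or_ge (dist x y) δ with h | h
      · have := abs_lt.1 (hd h)
        have h3 : 0 ≤ (n : ℝ) * dist x y := by positivity
        linarith [this.2]
      · have h3 : 2 * M ≤ n * dist x y := by
          calc 2 * M = n * δ := by rw [hnv]; field_simp
            _ ≤ _ := by gcongr
        linarith [(abs_le.1 (hM x)).2, (abs_le.1 (hM y)).1]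
    rw [abs_le]
    constructor <;> linarith

/-- A Lipschitz cut-off function between a compact set and an open neighbourhood. -/
lemma exists_lipschitz_cutoff {K U : Set X} (hK : IsCompact K) (hU : IsOpen U) (hKU : K ⊆ U) :
    ∃ (ψ : X → ℝ) (C : ℝ≥0), LipschitzWith C ψ ∧ (∀ x, 0 ≤ ψ x) ∧ (∀ x, ψ x ≤ 1) ∧
      (∀ x ∈ K, ψ x = 1) ∧ tsupport ψ ⊆ U := by
  obtain ⟨δ, hδ, hd⟩ := hK.exists_cthickening_subset_open hU hKU
  refine ⟨fun x => (thickenedIndicator hδ K x : ℝ), _, lipschitzWith_thickenedIndicator hδ K,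
    fun x => NNReal.coe_nonneg _, fun x => by exact_mod_cast thickenedIndicator_le_one hδ K x,
    fun x hx => by simp [thickenedIndicator_one hδ K hx], ?_⟩
  refine (closure_minimal (fun x hx => ?_) Metric.isClosed_cthickening).trans hd
  by_contra h
  have h' : x ∉ Metric.thickening δ K := fun h' => h (Metric.thickening_subset_cthickening _ _ h')
  exact hx (by simp [thickenedIndicator_zero hδ K h'])

lemma LipC.mul_mem_of_bounded (f : LipC X) {φ : X → ℝ} {C : ℝ≥0} (hφ : LipschitzWith C φ) {B : ℝ}
    (hb : ∀ x, |φ x| ≤ B) : (fun x => φ x * f x) ∈ LipC X := by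
  -- Rescaling by |B| + 1, positive whatever B is, reduces to a factor bounded by 1.
  have hB : 0 < |B| + 1 := by positivity
  have hlip := (lipschitzWith_smul (β := ℝ) (|B| + 1)⁻¹).comp hφ
  have h1 := LipC.mul_mem f hlip fun x => by
    simp only [Function.comp, smul_eq_mul, abs_mul, abs_inv, abs_of_pos hB]
    rw [inv_mul_le_iff₀ hB]
    have := hb x
    have := le_abs_self B
    linarith
  have h2 := (LipC X).smul_mem (|B| + 1) h1
  convert h2 using 1
  ext x
  simp only [Function.comp, Pi.smul_apply, smul_eq_mul]
  field_simp

variable [MeasurableSpace X]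

lemma BorelC.measurable (β : BorelC X) : Measurable β := β.2.1

lemma BorelC.isCompact_tsupport (β : BorelC X) : IsCompact (tsupport β) := β.2.2.2

variable [BorelSpace X]

/-- A function of `Lip_c(X)`, as an element of `B_c(X)`. -/
def LipC.toBorelC (f : LipC X) : BorelC X :=
  ⟨f, (LipC.continuous f).measurable, f.2.2.exists_bound_of_continuous (LipC.continuous f), f.2.2⟩

@[simp]
lemma LipC.toBorelC_apply (f : LipC X) (x : X) : LipC.toBorelC f x = f x := rfl

variable {ν : Measure X} [ν.Regular]

omit [BorelSpace X] in
lemma BorelC.integrable (β : BorelC X) : Integrable β ν := by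
  obtain ⟨C, hC⟩ := β.2.2.1
  have h1 : IntegrableOn β (tsupport β) ν :=
    Measure.integrableOn_of_bounded (M := C) (BorelC.isCompact_tsupport β).measure_lt_top.ne
      (BorelC.measurable β).aestronglyMeasurable (Eventually.of_forall hC)
  exact (integrableOn_iff_integrable_of_support_subset (subset_tsupport _)).1 h1

lemma BorelC.integrable_abs_sub (f : LipC X) (β : BorelC X) :
    Integrable (fun x => |f x - β x|) ν := by
  have := BorelC.integrable (ν := ν) (LipC.toBorelC f - β)
  exact this.abs

variable [LocallyCompactSpace X]

/-- Three approximations: β by a continuous compactly supported g in L¹, then g uniformly by a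
Lipschitz u, then u multiplied by a cut-off ψ that is 1 on the support of β. The cut-off keeps all
supports in the prescribed K, as the extension of T requires. -/
lemma BorelC.exists_integral_abs_sub_le (β : BorelC X) {K : Set X} (hK : IsCompact K)
    (h : tsupport β ⊆ interior K) {ε : ℝ} (hε : 0 < ε) :
    ∃ f : LipC X, tsupport f ⊆ K ∧ ∫ x, |f x - β x| ∂ν ≤ ε := by
  obtain ⟨g, hg1, hg2, hg3, hg4⟩ :=
    (BorelC.integrable (ν := ν) β).exists_hasCompactSupport_integral_sub_le (half_pos hε)
  obtain ⟨M, hM⟩ := hg1.exists_bound_of_continuous hg3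
  -- The uniform error is paid only on K, where it integrates to at most ε / 2; the + 1 covers ν(K)
  -- = 0.
  have hη : 0 < ε / 2 / (ν.real K + 1) := by positivity
  obtain ⟨u, C, hu, hug⟩ :=
    exists_lipschitzWith_abs_sub_le (hg1.uniformContinuous_of_continuous hg3) hM hη
  set η := ε / 2 / (ν.real K + 1) with hηd
  obtain ⟨ψ, D, hψ, hψ0, hψ1, hψK, hψs⟩ :=
    exists_lipschitz_cutoff (BorelC.isCompact_tsupport β) isOpen_interior h
  have hψs' : tsupport ψ ⊆ K := hψs.trans interior_subset
  let ψ' : LipC X := ⟨ψ, ⟨D, hψ⟩, hK.of_isClosed_subset (isClosed_tsupport _) hψs'⟩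
  have hub : ∀ x, |u x| ≤ M + η := fun x => by
    have := abs_add_le (u x - g x) (g x)
    rw [sub_add_cancel] at this
    have h2 : |g x| ≤ M := hM x
    linarith [hug x]
  refine ⟨⟨_, LipC.mul_mem_of_bounded ψ' hu hub⟩, ?_, ?_⟩
  · exact (tsupport_mul_subset_right (f := u) (g := ψ)).trans hψs'
  · have hbound : ∀ x, |u x * ψ x - β x| ≤ K.indicator (fun _ => η) x + ‖β x - g x‖ := by
      intro x
      have hβ : β x = β x * ψ x := by
        by_cases hx : x ∈ tsupport β
        · rw [hψK x hx, mul_one]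
        · rw [image_eq_zero_of_notMem_tsupport hx, zero_mul]
      -- Since β = ψ β, both errors carry the factor ψ, which is at most 1 and vanishes off K.
      have h1 : u x * ψ x - β x = ψ x * (u x - g x) + ψ x * (g x - β x) := by
        conv_lhs => rw [hβ]
        ring
      rw [h1]
      refine (abs_add_le _ _).trans (add_le_add ?_ ?_)
      · by_cases hx : x ∈ K
        · rw [indicator_of_mem hx, abs_mul, abs_of_nonneg (hψ0 x)]
          exact (mul_le_of_le_one_left (abs_nonneg _) (hψ1 x)).trans (hug x)
        · rw [image_eq_zero_of_notMem_tsupport fun h' => hx (hψs' h')]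
          simp [hx]
      · rw [abs_mul, abs_of_nonneg (hψ0 x), Real.norm_eq_abs, abs_sub_comm]
        exact mul_le_of_le_one_left (abs_nonneg _) (hψ1 x)
    have hi1 : Integrable (K.indicator fun _ => η) ν :=
      (integrable_indicator_iff hK.measurableSet).2 (integrableOn_const hK.measure_lt_top.ne)
    have hi2 : Integrable (fun x => ‖β x - g x‖) ν :=
      ((BorelC.integrable (ν := ν) β).sub hg4).norm
    calc ∫ x, |u x * ψ x - β x| ∂ν
        ≤ ∫ x, (K.indicator (fun _ => η) x + ‖β x - g x‖) ∂ν :=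
          integral_mono_of_nonneg (Eventually.of_forall fun x => abs_nonneg _) (hi1.add hi2)
            (Eventually.of_forall hbound)
      _ ≤ ε / 2 + ε / 2 := by
          rw [integral_add hi1 hi2]
          refine add_le_add ?_ hg2
          rw [integral_indicator_const _ hK.measurableSet, smul_eq_mul, hηd,
            mul_div_assoc', div_le_iff₀ (by positivity)]
          nlinarith [measureReal_nonneg (μ := ν) (s := K)]
      _ = ε := by ring

lemma BorelC.exists_seq (β : BorelC X) {K : Set X} (hK : IsCompact K)
    (h : tsupport β ⊆ interior K) : ∃ f : ℕ → LipC X, (∀ i, tsupport (f i) ⊆ K) ∧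
      Tendsto (fun i => ∫ x, |f i x - β x| ∂ν) atTop (𝓝 0) := by
  choose f hf1 hf2 using fun i : ℕ =>
    BorelC.exists_integral_abs_sub_le (ν := ν) β hK h (Nat.one_div_pos_of_nat (α := ℝ) (n := i))
  exact ⟨f, hf1, squeeze_zero (fun i => integral_nonneg fun x => abs_nonneg _) hf2
    tendsto_one_div_add_atTop_nhds_zero_nat⟩

omit [LocallyCompactSpace X] in
lemma BorelC.tendsto_lintegral_iff (β : BorelC X) (f : ℕ → LipC X) :
    Tendsto (fun i => ∫⁻ x, ENNReal.ofReal |f i x - β x| ∂ν) atTop (𝓝 0) ↔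
      Tendsto (fun i => ∫ x, |f i x - β x| ∂ν) atTop (𝓝 0) := by
  have h : ∀ i, ∫⁻ x, ENNReal.ofReal |f i x - β x| ∂ν = ENNReal.ofReal (∫ x, |f i x - β x| ∂ν) :=
    fun i => (ofReal_integral_eq_lintegral_ofReal (BorelC.integrable_abs_sub (f i) β)
      (Eventually.of_forall fun x => abs_nonneg _)).symm
  simp_rw [h]
  constructor
  · intro h'
    have := (ENNReal.tendsto_toReal ENNReal.zero_ne_top).comp h'
    refine this.congr fun i => ?_
    exact ENNReal.toReal_ofReal (integral_nonneg fun x => abs_nonneg _)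
  · intro h'
    simpa using ENNReal.tendsto_ofReal h'

omit [BorelSpace X] in
lemma BorelC.exists_compact_nhd (β : BorelC X) :
    ∃ K : Set X, IsCompact K ∧ tsupport β ⊆ interior K :=
  exists_compact_superset (BorelC.isCompact_tsupport β)

end Approximation

/-! ### Existence and uniqueness of the extension to `B_c(X)`. -/

section Extension

variable {X : Type*} [MetricSpace X] [LocallyCompactSpace X] [MeasurableSpace X] [BorelSpace X]
  {k : ℕ} {T : FormFunctional X k} [(mass T).Regular]

omit [LocallyCompactSpace X] in
lemma IsMetricCurrent.abs_sub_le (hT : IsMetricCurrent T) (β : BorelC X) (f f' : LipC X)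
    (g : Fin k → LipLoc X) {K : Set X} {L : Fin k → ℝ≥0} (hg : ∀ i, LipschitzOnWith (L i) (g i) K)
    (hf : tsupport f ⊆ K) (hf' : tsupport f' ⊆ K) :
    |T f g - T f' g| ≤ (∏ i, (L i : ℝ)) *
      (∫ x, |f x - β x| ∂(mass T) + ∫ x, |f' x - β x| ∂(mass T)) := by
  have hs : tsupport (f - f' : LipC X) ⊆ K := (tsupport_sub f.1 f'.1).trans (union_subset hf hf')
  have h1 := hT.abs_apply_le (f - f') g fun i => (hg i).mono hs
  rw [map_sub, sub_apply] at h1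
  refine h1.trans (mul_le_mul_of_nonneg_left ?_ (Finset.prod_nonneg fun i _ => NNReal.coe_nonneg _))
  rw [← integral_add (BorelC.integrable_abs_sub f β) (BorelC.integrable_abs_sub f' β)]
  refine integral_mono_of_nonneg (Eventually.of_forall fun x => abs_nonneg _)
    ((BorelC.integrable_abs_sub f β).add (BorelC.integrable_abs_sub f' β))
    (Eventually.of_forall fun x => ?_)
  have := abs_sub (f x - β x) (f' x - β x)
  rw [sub_sub_sub_cancel_right] at this
  exact this

/-- By the mass estimate, L¹ convergence makes T(fᵢ, g) a Cauchy sequence. A second approximating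
sequence, with supports in K', gives the same limit by the same estimate with the Lipschitz
constants of the gⁱ on K ∪ K'. -/
lemma IsMetricCurrent.exists_limit (hT : IsMetricCurrent T) (β : BorelC X) (g : Fin k → LipLoc X) :
    ∃ a : ℝ, ∀ f : ℕ → LipC X, (∃ K, IsCompact K ∧ ∀ i, tsupport (f i) ⊆ K) →
      Tendsto (fun i => ∫ x, |f i x - β x| ∂(mass T)) atTop (𝓝 0) →
      Tendsto (fun i => T (f i) g) atTop (𝓝 a) := by
  obtain ⟨K, hK, hβ⟩ := BorelC.exists_compact_nhd β
  obtain ⟨f, hf1, hf2⟩ := BorelC.exists_seq (ν := mass T) β hK hβ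
  choose L hL using fun i => LipLoc.exists_lipschitzOnWith (g i) hK
  have hc : CauchySeq fun i => T (f i) g := by
    rw [Metric.cauchySeq_iff']
    intro ε hε
    set C := ∏ i, (L i : ℝ) with hC
    have hC0 : 0 ≤ C := Finset.prod_nonneg fun i _ => NNReal.coe_nonneg _
    have hη : 0 < ε / (2 * (C + 1)) := by positivity
    obtain ⟨N, hN⟩ := eventually_atTop.1 (hf2.eventually (gt_mem_nhds hη))
    refine ⟨N, fun n hn => ?_⟩
    rw [Real.dist_eq]
    refine (hT.abs_sub_le β (f n) (f N) g hL (hf1 n) (hf1 N)).trans_lt ?_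
    have h1 := hN n hn
    have h2 := hN N le_rfl
    calc C * (∫ x, |f n x - β x| ∂(mass T) + ∫ x, |f N x - β x| ∂(mass T))
        ≤ C * (ε / (2 * (C + 1)) + ε / (2 * (C + 1))) := by gcongr
      _ = ε * (C / (C + 1)) := by field_simp; ring
      _ < ε * 1 := by
          refine mul_lt_mul_of_pos_left ?_ hε
          rw [div_lt_one (by positivity)]; linarith
      _ = ε := mul_one ε
  obtain ⟨a, ha⟩ := cauchySeq_tendsto_of_complete hc
  refine ⟨a, ?_⟩
  rintro f' ⟨K', hK', hf1'⟩ hf2'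
  choose L' hL' using fun i => LipLoc.exists_lipschitzOnWith (g i) (hK.union hK')
  have h0 : Tendsto (fun i => T (f' i) g - T (f i) g) atTop (𝓝 0) := by
    refine squeeze_zero_norm (fun i => hT.abs_sub_le β (f' i) (f i) g hL'
      ((hf1' i).trans subset_union_right) ((hf1 i).trans subset_union_left)) ?_
    simpa using (hf2'.add hf2).const_mul (∏ i, (L' i : ℝ))
  simpa using h0.add ha

/-- Linearity passes to the limit. In g this works because one approximating sequence of β serves
all g; in β because sums and multiples of approximating sequences approximate sums and multiples. -/
lemma IsMetricCurrent.exists_canonicalExtension (hT : IsMetricCurrent T) :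
    ∃ T' : MeasFormFunctional X k, IsCanonicalExtension T T' := by
  choose E hE using fun β : BorelC X => hT.exists_limit β
  have happ : ∀ β : BorelC X, ∃ f : ℕ → LipC X, (∃ K, IsCompact K ∧ ∀ i, tsupport (f i) ⊆ K) ∧
      Tendsto (fun i => ∫ x, |f i x - β x| ∂(mass T)) atTop (𝓝 0) := fun β => by
    obtain ⟨K, hK, hβ⟩ := BorelC.exists_compact_nhd β
    obtain ⟨f, hf1, hf2⟩ := BorelC.exists_seq (ν := mass T) β hK hβ
    exact ⟨f, ⟨K, hK, hf1⟩, hf2⟩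
  let E' : BorelC X → MultilinearMap ℝ (fun _ : Fin k => LipLoc X) ℝ := fun β =>
    { toFun := E β
      map_update_add' := by
        intro _ g i u v
        obtain ⟨f, hf, hf'⟩ := happ β
        refine tendsto_nhds_unique (hE β _ f hf hf') ?_
        simp only [MultilinearMap.map_update_add]
        exact (hE β _ f hf hf').add (hE β _ f hf hf')
      map_update_smul' := by
        intro _ g i c u
        obtain ⟨f, hf, hf'⟩ := happ β
        refine tendsto_nhds_unique (hE β _ f hf hf') ?_
        simp only [MultilinearMap.map_update_smul]
        exact (hE β _ f hf hf').const_smul c }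
  refine ⟨⟨⟨E', fun β γ => ?_⟩, fun c β => ?_⟩, fun β f g hf hf' =>
    hE β g f hf ((BorelC.tendsto_lintegral_iff β f).1 hf')⟩
  · ext g
    obtain ⟨f, ⟨K, hK, hfK⟩, hf'⟩ := happ β
    obtain ⟨h, ⟨K', hK', hhK⟩, hh'⟩ := happ γ
    have h1 := hE (β + γ) g (fun i => f i + h i) ⟨K ∪ K', hK.union hK', fun i =>
      (tsupport_add (f i).1 (h i).1).trans (union_subset_union (hfK i) (hhK i))⟩ (by
        refine squeeze_zero (fun i => integral_nonneg fun x => abs_nonneg _) (fun i => ?_)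
          (by simpa using hf'.add hh')
        rw [← integral_add (BorelC.integrable_abs_sub (f i) β) (BorelC.integrable_abs_sub (h i) γ)]
        refine integral_mono_of_nonneg (Eventually.of_forall fun x => abs_nonneg _)
          ((BorelC.integrable_abs_sub (f i) β).add (BorelC.integrable_abs_sub (h i) γ))
          (Eventually.of_forall fun x => ?_)
        have := abs_add_le (f i x - β x) (h i x - γ x)
        rw [sub_add_sub_comm] at this
        exact this)
    refine tendsto_nhds_unique h1 ?_
    simp only [map_add, add_apply]
    exact (hE β g f ⟨K, hK, hfK⟩ hf').add (hE γ g h ⟨K', hK', hhK⟩ hh')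
  · ext g
    obtain ⟨f, ⟨K, hK, hfK⟩, hf'⟩ := happ β
    have h1 := hE (c • β) g (fun i => c • f i) ⟨K, hK, fun i =>
      (closure_mono (Function.support_const_smul_subset c (f i).1)).trans (hfK i)⟩ (by
        have := hf'.const_mul |c|
        rw [mul_zero] at this
        refine this.congr fun i => ?_
        rw [← integral_const_mul]
        refine integral_congr_ae (Eventually.of_forall fun x => ?_)
        show |c| * |f i x - β x| = |c * f i x - c * β x|
        rw [← mul_sub, abs_mul])
    refine tendsto_nhds_unique h1 ?_
    simp only [map_smul, smul_apply]
    exact (hE β g f ⟨K, hK, hfK⟩ hf').const_smul c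

variable {T' : MeasFormFunctional X k}

omit [LocallyCompactSpace X] in
lemma IsCanonicalExtension.tendsto (hE : IsCanonicalExtension T T') {β : BorelC X}
    {f : ℕ → LipC X} (g : Fin k → LipLoc X) {K : Set X} (hK : IsCompact K)
    (hf : ∀ i, tsupport (f i) ⊆ K)
    (h : Tendsto (fun i => ∫ x, |f i x - β x| ∂(mass T)) atTop (𝓝 0)) :
    Tendsto (fun i => T (f i) g) atTop (𝓝 (T' β g)) :=
  hE β f g ⟨K, hK, hf⟩ ((BorelC.tendsto_lintegral_iff β f).2 h)

lemma IsCanonicalExtension.unique {T'' : MeasFormFunctional X k} (hE : IsCanonicalExtension T T')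
    (hE' : IsCanonicalExtension T T'') : T' = T'' := by
  ext β g
  obtain ⟨K, hK, hβ⟩ := BorelC.exists_compact_nhd β
  obtain ⟨f, hf1, hf2⟩ := BorelC.exists_seq (ν := mass T) β hK hβ
  exact tendsto_nhds_unique (hE.tendsto g hK hf1 hf2) (hE'.tendsto g hK hf1 hf2)

/-- Limit of the mass estimate for T. The approximating functions may spill out of the support of β,
so at this stage Lipschitz constants on a compact neighbourhood are needed; strict locality later
removes this restriction. -/
lemma IsCanonicalExtension.abs_apply_le_of_nhd (hE : IsCanonicalExtension T T')
    (hT : IsMetricCurrent T) (β : BorelC X) (g : Fin k → LipLoc X) {K : Set X} (hK : IsCompact K)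
    (hβ : tsupport β ⊆ interior K) {L : Fin k → ℝ≥0} (hg : ∀ i, LipschitzOnWith (L i) (g i) K) :
    |T' β g| ≤ (∏ i, (L i : ℝ)) * ∫ x, |β x| ∂(mass T) := by
  obtain ⟨f, hf1, hf2⟩ := BorelC.exists_seq (ν := mass T) β hK hβ
  have h1 : Tendsto (fun i => |T (f i) g|) atTop (𝓝 |T' β g|) :=
    (hE.tendsto g hK hf1 hf2).abs
  have h2 : Tendsto (fun i => (∏ i, (L i : ℝ)) *
      (∫ x, |f i x - β x| ∂(mass T) + ∫ x, |β x| ∂(mass T))) atTop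
      (𝓝 ((∏ i, (L i : ℝ)) * (0 + ∫ x, |β x| ∂(mass T)))) :=
    (hf2.add_const _).const_mul _
  rw [zero_add] at h2
  refine le_of_tendsto_of_tendsto' h1 h2 fun i => ?_
  refine (hT.abs_apply_le (f i) g fun j => (hg j).mono (hf1 i)).trans ?_
  refine mul_le_mul_of_nonneg_left ?_ (Finset.prod_nonneg fun i _ => NNReal.coe_nonneg _)
  have hi := BorelC.integrable_abs_sub (ν := mass T) (f i) β
  have hi' := (BorelC.integrable (ν := mass T) β).abs
  rw [← integral_add hi hi']
  refine integral_mono_of_nonneg (Eventually.of_forall fun x => abs_nonneg _) (hi.add hi')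
    (Eventually.of_forall fun x => ?_)
  have := abs_add_le (f i x - β x) (β x)
  rw [sub_add_cancel] at this
  exact this

end Extension

/-! ### One-variable Lipschitz functions behind strict locality and alternation. -/

section Truncation

/-- A Lipschitz function which is equal to `c` on `[c - ε, c + ε]` and `ε`-close to the identity. -/
def truncAround (c ε t : ℝ) : ℝ := c + (max (t - c - ε) 0 + min (t - c + ε) 0)

lemma lipschitzWith_truncAround (c ε : ℝ) : LipschitzWith 2 (truncAround c ε) := by
  have h1 : LipschitzWith 1 fun t : ℝ => t - c - ε :=
    LipschitzWith.of_dist_le_mul fun x y => by simp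
  have h2 : LipschitzWith 1 fun t : ℝ => t - c + ε :=
    LipschitzWith.of_dist_le_mul fun x y => by simp
  have := (LipschitzWith.const c).add ((h1.max_const 0).add (h2.min_const 0))
  rwa [zero_add, one_add_one_eq_two] at this

lemma truncAround_eq {c ε t : ℝ} (h : |t - c| ≤ ε) : truncAround c ε t = c := by
  rw [abs_le] at h
  rw [truncAround, max_eq_right (by linarith), min_eq_right (by linarith)]
  ring

lemma abs_truncAround_sub_le {c ε : ℝ} (hε : 0 ≤ ε) (t : ℝ) : |truncAround c ε t - t| ≤ ε := by
  rw [truncAround, abs_le]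
  rcases max_cases (t - c - ε) 0 with ⟨h1, h2⟩ | ⟨h1, h2⟩ <;>
  rcases min_cases (t - c + ε) 0 with ⟨h3, h4⟩ | ⟨h3, h4⟩ <;> rw [h1, h3] <;>
  constructor <;> linarith

/-- The distance to the nearest integer. -/
def distInt (t : ℝ) : ℝ := |t - round t|

lemma lipschitzWith_distInt : LipschitzWith 1 distInt := by
  refine LipschitzWith.of_le_add fun s t => ?_
  refine (round_le s (round t)).trans ?_
  have := abs_add_le (s - t) (t - round t)
  rw [sub_add_sub_cancel] at this
  rw [Real.dist_eq, distInt]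
  linarith

lemma lipschitzWith_distInt_mul_div {N : ℝ} (hN : 0 < N) :
    LipschitzWith 1 fun t => distInt (N * t) / N := by
  refine LipschitzWith.of_dist_le_mul fun x y => ?_
  have := lipschitzWith_distInt.dist_le_mul (N * x) (N * y)
  rw [Real.dist_eq, Real.dist_eq, ← mul_sub, abs_mul, abs_of_pos hN] at this
  rw [Real.dist_eq, Real.dist_eq, ← sub_div, abs_div, abs_of_pos hN, div_le_iff₀ hN]
  linarith

/-- For N t between an integer m and m + 1/2 this map takes the constant value m / N; for N t
between m - 1/2 and m its companion with a plus sign does. Both tend to the identity as N → ∞ with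
Lipschitz constant 2, and this drives the proof that T' is alternating. -/
lemma lipschitzWith_sub_distInt {N : ℝ} (hN : 0 < N) :
    LipschitzWith 2 fun t => t - distInt (N * t) / N := by
  have := LipschitzWith.id.sub (lipschitzWith_distInt_mul_div hN)
  rwa [one_add_one_eq_two] at this

lemma lipschitzWith_add_distInt {N : ℝ} (hN : 0 < N) :
    LipschitzWith 2 fun t => t + distInt (N * t) / N := by
  have := LipschitzWith.id.add (lipschitzWith_distInt_mul_div hN)
  rwa [one_add_one_eq_two] at this

lemma tendsto_distInt_mul_div (t : ℝ) :
    Tendsto (fun N : ℕ => distInt (((N : ℝ) + 1) * t) / ((N : ℝ) + 1)) atTop (𝓝 0) := by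
  refine squeeze_zero (fun N => div_nonneg (abs_nonneg _) (by positivity)) (fun N => ?_)
    tendsto_one_div_add_atTop_nhds_zero_nat
  refine div_le_div_of_nonneg_right ((abs_sub_round _).trans (by norm_num)) (by positivity)

end Truncation

/-! ### Convergence in `Lip_loc(X)`. -/

section Converges

variable {X : Type*} [MetricSpace X]

lemma LipLoc.converges_const (g : LipLoc X) : LipLoc.Converges (fun _ => g) g :=
  ⟨fun _ => tendsto_const_nhds, fun _ hK => by
    obtain ⟨C, hC⟩ := LipLoc.exists_lipschitzOnWith g hK
    exact ⟨C, hC, fun _ => hC⟩⟩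

lemma LipLoc.converges_comp (g : LipLoc X) {φ : ℕ → ℝ → ℝ} {C : ℝ≥0} (hφ : ∀ n, LipschitzWith C (φ n))
    (h : ∀ t, Tendsto (fun n => φ n t) atTop (𝓝 t)) :
    LipLoc.Converges (fun n => LipLoc.comp (hφ n) g) g :=
  ⟨fun x => h (g x), fun K hK => by
    obtain ⟨L, hL⟩ := LipLoc.exists_lipschitzOnWith g hK
    exact ⟨max L (C * L), hL.weaken (le_max_left _ _), fun n =>
      ((hφ n).comp_lipschitzOnWith hL).weaken (le_max_right _ _)⟩⟩

end Converges

/-! ### Continuity, strict locality, mass estimates and alternation of the extension. -/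

section Extension

variable {X : Type*} [MetricSpace X] [LocallyCompactSpace X] [MeasurableSpace X] [BorelSpace X]
  {k : ℕ} {T : FormFunctional X k} [(mass T).Regular] {T' : MeasFormFunctional X k}

omit [LocallyCompactSpace X] in
lemma IsCanonicalExtension.apply_toBorelC (hE : IsCanonicalExtension T T') (f : LipC X)
    (g : Fin k → LipLoc X) : T' (LipC.toBorelC f) g = T f g := by
  have h := hE.tendsto (β := LipC.toBorelC f) (f := fun _ => f) g f.2.2 (fun _ => subset_rfl)
    (by simp)
  exact tendsto_nhds_unique h tendsto_const_nhds

omit [MeasurableSpace X] [BorelSpace X] in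
lemma exists_compact_interior {K : Set X} (hK : IsCompact K) :
    ∃ K' : Set X, IsCompact K' ∧ K ⊆ interior K' := exists_compact_superset hK

/-- `T'(β, ·)` is continuous. -/
lemma IsCanonicalExtension.tendsto_of_converges (hE : IsCanonicalExtension T T')
    (hT : IsMetricCurrent T) (β : BorelC X) {g : ℕ → Fin k → LipLoc X} {g' : Fin k → LipLoc X}
    (hg : ∀ j, LipLoc.Converges (fun i => g i j) (g' j)) :
    Tendsto (fun i => T' β (g i)) atTop (𝓝 (T' β g')) := by
  obtain ⟨K, hK, hβ⟩ := BorelC.exists_compact_nhd β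
  obtain ⟨K', hK', hKK'⟩ := exists_compact_interior hK
  -- The constants hold for the whole sequence and its limit, on a neighbourhood of a compact set
  -- containing the supports of β and of its approximation.
  choose L hL hL' using fun j => (hg j).2 K' hK'
  set C := ∏ i, (L i : ℝ) with hC
  have hC0 : 0 ≤ C := Finset.prod_nonneg fun i _ => NNReal.coe_nonneg _
  rw [Metric.tendsto_atTop]
  intro ε hε
  have hη : 0 < ε / (3 * (C + 1)) := by positivity
  obtain ⟨f, hfK, hf⟩ := BorelC.exists_integral_abs_sub_le (ν := mass T) β hK hβ hη
  -- The error of replacing β by f is uniform over all tuples with these constants, so continuity of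
  -- T at the fixed f closes an ε / 3 argument.
  have hest : ∀ u : Fin k → LipLoc X, (∀ j, LipschitzOnWith (L j) (u j) K') →
      |T f u - T' β u| ≤ ε / 3 := by
    intro u hu
    have hs : tsupport (LipC.toBorelC f - β : BorelC X) ⊆ interior K' :=
      ((tsupport_sub f.1 β.1).trans
        (union_subset hfK (hβ.trans interior_subset))).trans hKK'
    have h1 := hE.abs_apply_le_of_nhd hT (LipC.toBorelC f - β) u hK' hs hu
    rw [map_sub, sub_apply, hE.apply_toBorelC] at h1
    refine h1.trans ?_
    calc C * ∫ x, |f x - β x| ∂(mass T) ≤ C * (ε / (3 * (C + 1))) := by gcongr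
      _ = ε / 3 * (C / (C + 1)) := by field_simp
      _ ≤ ε / 3 * 1 := by
          gcongr
          rw [div_le_one (by positivity)]; linarith
      _ = ε / 3 := mul_one _
  have hconv := hT.continuity (fun _ => f) f g g' ⟨fun _ => tendsto_const_nhds,
    ⟨_, f.2.1.choose_spec, fun _ => f.2.1.choose_spec⟩, ⟨_, f.2.2, subset_rfl, fun _ => subset_rfl⟩⟩
    hg
  obtain ⟨N, hN⟩ := Metric.tendsto_atTop.1 hconv (ε / 3) (by positivity)
  refine ⟨N, fun n hn => ?_⟩
  have h1 := hest (g n) fun j => hL' j n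
  have h2 := hest g' hL
  have h3 := hN n hn
  rw [Real.dist_eq] at h3 ⊢
  rw [abs_le] at h1 h2
  rw [abs_lt] at h3 ⊢
  constructor <;> linarith

/-- The strict locality of `T'`: `T'(β, g)` vanishes if some `gⁱ` is constant on a set outside of
which `β` vanishes. -/
lemma IsCanonicalExtension.apply_eq_zero_of_const (hE : IsCanonicalExtension T T')
    (hT : IsMetricCurrent T) (β : BorelC X) (g : Fin k → LipLoc X) {P : Set X}
    (hβ : ∀ x ∉ P, β x = 0) (i : Fin k) {c : ℝ} (hg : ∀ x ∈ P, g i x = c) : T' β g = 0 := by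
  obtain ⟨K, hK, hβK⟩ := BorelC.exists_compact_nhd β
  obtain ⟨f, hf1, hf2⟩ := BorelC.exists_seq (ν := mass T) β hK hβK
  -- By continuity gⁱ = c also on the closed support; but functions approximating β may live
  -- slightly outside it, where the locality of T says nothing.
  have hP : tsupport β ⊆ {x | g i x = c} := by
    refine closure_minimal (fun x hx => ?_) (isClosed_eq (LipLoc.continuous _) continuous_const)
    by_contra h
    exact hx (hβ x fun hxP => h (hg x hxP))
  -- Flattening gⁱ to the value c wherever |gⁱ - c| ≤ ε makes it constant on a neighbourhood of the
  -- support. Approximations of β cut off to that neighbourhood are killed by the locality of T.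
  have key : ∀ ε : ℝ, 0 < ε →
      T' β (Function.update g i (LipLoc.comp (lipschitzWith_truncAround c ε) (g i))) = 0 := by
    intro ε hε
    have hU : IsOpen {x | |g i x - c| < ε} :=
      isOpen_lt ((LipLoc.continuous _).sub continuous_const).abs continuous_const
    obtain ⟨ψ, C, hψ, hψ0, hψ1, hψK, hψs⟩ := exists_lipschitz_cutoff (BorelC.isCompact_tsupport β)
      hU fun x hx => by
        have : g i x = c := hP hx
        simpa [this] using hε
    have hψb : ∀ x, |ψ x| ≤ 1 := fun x => by rw [abs_of_nonneg (hψ0 x)]; exact hψ1 x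
    let f' : ℕ → LipC X := fun n => ⟨_, LipC.mul_mem (f n) hψ hψb⟩
    have hs : ∀ n, tsupport (f' n) ⊆ tsupport ψ ∩ tsupport (f n) := fun n =>
      subset_inter tsupport_mul_subset_left tsupport_mul_subset_right
    have hlim : Tendsto (fun n => ∫ x, |f' n x - β x| ∂(mass T)) atTop (𝓝 0) := by
      refine squeeze_zero (fun n => integral_nonneg fun x => abs_nonneg _) (fun n => ?_) hf2
      refine integral_mono_of_nonneg (Eventually.of_forall fun x => abs_nonneg _)
        (BorelC.integrable_abs_sub _ _) (Eventually.of_forall fun x => ?_)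
      have hβ' : β x = ψ x * β x := by
        by_cases hx : x ∈ tsupport β
        · rw [hψK x hx, one_mul]
        · rw [image_eq_zero_of_notMem_tsupport hx, mul_zero]
      show |ψ x * f n x - β x| ≤ |f n x - β x|
      rw [hβ', ← mul_sub, abs_mul, ← hβ']
      exact mul_le_of_le_one_left (abs_nonneg _) (hψb x)
    refine tendsto_nhds_unique (hE.tendsto _ hK (fun n => (hs n).trans (inter_subset_right.trans
      (hf1 n))) hlim) ?_
    refine tendsto_const_nhds.congr fun n => (hT.locality _ _ ⟨i, c, fun x hx => ?_⟩).symm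
    have hx' : |g i x - c| < ε := hψs (hs n hx).1
    simp [truncAround_eq hx'.le]
  have hε : ∀ n : ℕ, (0 : ℝ) < 1 / ((n : ℝ) + 1) := fun n => Nat.one_div_pos_of_nat
  -- The flattened functions converge to gⁱ with the factor 2 independent of ε, so continuity in g
  -- transfers the vanishing.
  have hconv := hE.tendsto_of_converges hT β (g := fun n => Function.update g i
    (LipLoc.comp (lipschitzWith_truncAround c (1 / ((n : ℝ) + 1))) (g i))) (g' := g) fun j => by
      by_cases hj : j = i
      · subst hj
        simp only [Function.update_self]
        refine LipLoc.converges_comp (g j) (fun n => lipschitzWith_truncAround c _) fun t => ?_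
        rw [tendsto_iff_norm_sub_tendsto_zero]
        exact squeeze_zero (fun n => norm_nonneg _)
          (fun n => abs_truncAround_sub_le (hε n).le t) tendsto_one_div_add_atTop_nhds_zero_nat
      · simp only [Function.update_of_ne hj]
        exact LipLoc.converges_const _
  refine tendsto_nhds_unique hconv ?_
  exact tendsto_const_nhds.congr fun n => (key _ (hε n)).symm

lemma IsCanonicalExtension.congr_of_eqOn (hE : IsCanonicalExtension T T')
    (hT : IsMetricCurrent T) (β : BorelC X) (g g' : Fin k → LipLoc X) {P : Set X}
    (hβ : ∀ x ∉ P, β x = 0) (h : ∀ i, EqOn (g i) (g' i) P) : T' β g = T' β g' := by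
  refine multilinearMap_congr_of_sub (T' β) (fun u => ∀ x ∈ P, u x = 0)
    (fun g i hi => hE.apply_eq_zero_of_const hT β g hβ i hi) g g' fun i x hx => ?_
  have := h i hx
  simpa [sub_eq_zero] using this

/-- The mass estimate for `T'`, in terms of the Lipschitz constants of the `gⁱ` on any set outside
of which `β` vanishes. -/
lemma IsCanonicalExtension.abs_apply_le (hE : IsCanonicalExtension T T')
    (hT : IsMetricCurrent T) (β : BorelC X) (g : Fin k → LipLoc X) {P : Set X}
    (hβ : ∀ x ∉ P, β x = 0) {L : Fin k → ℝ≥0} (hg : ∀ i, LipschitzOnWith (L i) (g i) P) :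
    |T' β g| ≤ (∏ i, (L i : ℝ)) * ∫ x, |β x| ∂(mass T) := by
  -- Strict locality permits replacing gⁱ by a globally Lᵢ-Lipschitz extension of its restriction to
  -- P.
  choose g' hg' hgg' using fun i => LipLoc.exists_extension (g i) (hg i)
  obtain ⟨K, hK, hβK⟩ := BorelC.exists_compact_nhd β
  rw [hE.congr_of_eqOn hT β g g' hβ hgg']
  exact hE.abs_apply_le_of_nhd hT β g' hK hβK fun i => (hg' i).lipschitzOnWith

lemma IsCanonicalExtension.tendsto_of_integral (hE : IsCanonicalExtension T T')
    (hT : IsMetricCurrent T) {β : BorelC X} {γ : ℕ → BorelC X} (g : Fin k → LipLoc X) {K : Set X}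
    (hK : IsCompact K) (hγ : ∀ n, ∀ x ∉ K, γ n x = 0) (hβ : ∀ x ∉ K, β x = 0)
    (h : Tendsto (fun n => ∫ x, |γ n x - β x| ∂(mass T)) atTop (𝓝 0)) :
    Tendsto (fun n => T' (γ n) g) atTop (𝓝 (T' β g)) := by
  choose L hL using fun i => LipLoc.exists_lipschitzOnWith (g i) hK
  rw [tendsto_iff_norm_sub_tendsto_zero]
  have h2 := h.const_mul (∏ i, (L i : ℝ))
  rw [mul_zero] at h2
  refine squeeze_zero (fun n => norm_nonneg _) (fun n => ?_) h2
  have := hE.abs_apply_le hT (γ n - β) g (P := K) (fun x hx => by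
    show γ n x - β x = 0
    rw [hγ n x hx, hβ x hx, sub_zero]) hL
  rwa [map_sub, sub_apply] at this

omit [LocallyCompactSpace X] [BorelSpace X] in
@[simp]
lemma BorelC.indicator_apply {A : Set X} (hA : MeasurableSet A) (β : BorelC X) (x : X) :
    BorelC.indicator hA β x = A.indicator β x := rfl

/-- `T'(χ_A β, g)` is continuous along increasing unions. -/
lemma IsCanonicalExtension.tendsto_indicator (hE : IsCanonicalExtension T T')
    (hT : IsMetricCurrent T) (β : BorelC X) (g : Fin k → LipLoc X) {A : ℕ → Set X}
    (hA : ∀ n, MeasurableSet (A n)) (hmono : Monotone A) (hβ : ∀ x ∉ ⋃ n, A n, β x = 0) :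
    Tendsto (fun n => T' (BorelC.indicator (hA n) β) g) atTop (𝓝 (T' β g)) := by
  have hβK : ∀ x ∉ tsupport β, β x = 0 := fun x hx => image_eq_zero_of_notMem_tsupport hx
  refine hE.tendsto_of_integral hT g (BorelC.isCompact_tsupport β) (fun n x hx => ?_) hβK ?_
  · simp [hβK x hx]
  · have hz : (0 : ℝ) = ∫ x : X, (0 : ℝ) ∂(mass T) := by simp
    rw [hz]
    refine tendsto_integral_of_dominated_convergence (fun x => |β x|) (fun n => ?_)
      (BorelC.integrable β).abs (fun n => Eventually.of_forall fun x => ?_)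
      (Eventually.of_forall fun x => ?_)
    · exact ((BorelC.measurable _).sub (BorelC.measurable β)).abs.aestronglyMeasurable
    · rw [BorelC.indicator_apply]
      by_cases hx : x ∈ A n <;> simp [hx]
    · by_cases hx : x ∈ ⋃ n, A n
      · obtain ⟨m, hm⟩ := mem_iUnion.1 hx
        refine tendsto_const_nhds.congr' ?_
        filter_upwards [eventually_ge_atTop m] with n hn
        rw [BorelC.indicator_apply, indicator_of_mem (hmono hn hm), sub_self, abs_zero]
      · have h0 : ∀ n, (A n).indicator β x = 0 := fun n => by
          by_cases hxn : x ∈ A n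
          · rw [indicator_of_mem hxn, hβ x hx]
          · exact indicator_of_notMem hxn _
        simp [h0, hβ x hx]

/-- An estimate for `T'` holds as soon as it holds on each of the members of a countable cover. -/
lemma IsCanonicalExtension.abs_apply_le_of_cover (hE : IsCanonicalExtension T T')
    (hT : IsMetricCurrent T) (β : BorelC X) (g : Fin k → LipLoc X) {Q : ℕ → Set X}
    (hQ : ∀ n, MeasurableSet (Q n)) (hβ : ∀ x ∉ ⋃ n, Q n, β x = 0) {C : ℝ} (hC : 0 ≤ C)
    (h : ∀ n, ∀ γ : BorelC X, (∀ x ∉ Q n, γ x = 0) → |T' γ g| ≤ C * ∫ x, |γ x| ∂(mass T)) :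
    |T' β g| ≤ C * ∫ x, |β x| ∂(mass T) := by
  have hQ' : ∀ n, MeasurableSet (partialSups Q n) := fun n => by
    rw [partialSups_eq_biUnion_range]
    exact Finset.measurableSet_biUnion _ fun i _ => hQ i
  have hD : ∀ n, MeasurableSet (disjointed Q n) := fun n => MeasurableSet.disjointed hQ n
  have hlim := hE.tendsto_indicator hT β g hQ' (partialSups Q).monotone (by
    rwa [← Set.iSup_eq_iUnion, iSup_partialSups_eq, Set.iSup_eq_iUnion])
  refine le_of_tendsto hlim.abs (Eventually.of_forall fun n => ?_)
  -- Over disjoint pieces the L¹ norms add up to at most that of β, so the constant C is not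
  -- enlarged by the summation.
  have hpt : ∀ n x, (partialSups Q n).indicator β x =
      ∑ j ∈ Finset.range (n + 1), (disjointed Q j).indicator β x := by
    intro n x
    rw [← partialSups_disjointed, partialSups_eq_biUnion_range,
      Finset.indicator_biUnion_apply]
    exact fun i _ j _ hij => disjoint_disjointed Q hij
  have hsum : BorelC.indicator (hQ' n) β =
      ∑ j ∈ Finset.range (n + 1), BorelC.indicator (hD j) β := by
    ext x
    have := hpt n x
    simpa using this
  have habs : ∀ x, ∑ j ∈ Finset.range (n + 1), |(disjointed Q j).indicator β x| ≤ |β x| := by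
    intro x
    have h1 : ∀ j, |(disjointed Q j).indicator β x| = (disjointed Q j).indicator (|β.1|) x :=
      fun j => by by_cases hx : x ∈ disjointed Q j <;> simp [hx]
    simp_rw [h1]
    rw [← Finset.indicator_biUnion_apply]
    · refine indicator_le_self' (fun _ _ => abs_nonneg _) x
    · exact fun i _ j _ hij => disjoint_disjointed Q hij
  rw [hsum, map_sum, sum_apply]
  calc |∑ j ∈ Finset.range (n + 1), T' (BorelC.indicator (hD j) β) g|
      ≤ ∑ j ∈ Finset.range (n + 1), |T' (BorelC.indicator (hD j) β) g| :=
        Finset.abs_sum_le_sum_abs _ _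
    _ ≤ ∑ j ∈ Finset.range (n + 1), C * ∫ x, |BorelC.indicator (hD j) β x| ∂(mass T) := by
        refine Finset.sum_le_sum fun j _ => h j _ fun x hx => ?_
        exact indicator_of_notMem (fun h' => hx (disjointed_subset Q j h')) _
    _ = C * ∫ x, ∑ j ∈ Finset.range (n + 1), |(disjointed Q j).indicator β x| ∂(mass T) := by
        rw [← Finset.mul_sum, integral_finsetSum]
        · rfl
        · exact fun j _ => (BorelC.integrable (BorelC.indicator (hD j) β)).abs
    _ ≤ C * ∫ x, |β x| ∂(mass T) := by
        refine mul_le_mul_of_nonneg_left ?_ hC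
        exact integral_mono_of_nonneg
          (Eventually.of_forall fun x => Finset.sum_nonneg fun j _ => abs_nonneg _)
          (BorelC.integrable β).abs (Eventually.of_forall habs)

/-- The mass estimate for `T'`, in terms of the pointwise Lipschitz constants of the `gⁱ` along a
set outside of which `β` vanishes. -/
lemma IsCanonicalExtension.abs_apply_le_of_eventually [TopologicalSpace.SeparableSpace X]
    (hE : IsCanonicalExtension T T') (hT : IsMetricCurrent T) (β : BorelC X)
    (g : Fin k → LipLoc X) {A : Set X} (hA : MeasurableSet A) (hβ : ∀ x ∉ A, β x = 0)
    {L : Fin k → ℝ≥0}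
    (hg : ∀ i, ∀ y ∈ A, ∀ᶠ x in 𝓝[A] y, |g i x - g i y| ≤ L i * dist x y) :
    |T' β g| ≤ (∏ i, (L i : ℝ)) * ∫ x, |β x| ∂(mass T) := by
  rcases isEmpty_or_nonempty X with hX | hX
  · have : β = 0 := Subtype.ext (funext fun x => isEmptyElim x)
    simp [this]
  let r : ℕ → ℝ := fun m => 1 / ((m : ℝ) + 1)
  have hr : ∀ m, 0 < r m := fun m => Nat.one_div_pos_of_nat
  -- The points of A at which the pointwise Lipschitz bound is already valid at the scale r m.
  let S : ℕ → Set X := fun m =>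
    {y | y ∈ A ∧ ∀ i, ∀ x ∈ A, dist x y < r m → |g i x - g i y| ≤ L i * dist x y}
  -- The condition is closed relative to A, because the strict inequality dist x y < r m persists
  -- under small changes of y. This gives measurability.
  have hS : ∀ m, S m = A ∩ closure (S m) := by
    intro m
    refine subset_antisymm (fun y hy => ⟨hy.1, subset_closure hy⟩) ?_
    rintro y ⟨hyA, hy⟩
    refine ⟨hyA, fun i x hx hxy => ?_⟩
    obtain ⟨u, hu, hlim⟩ := mem_closure_iff_seq_limit.1 hy
    have h1 : Tendsto (fun n => dist x (u n)) atTop (𝓝 (dist x y)) := tendsto_const_nhds.dist hlim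
    have h2 : Tendsto (fun n => |g i x - g i (u n)|) atTop (𝓝 |g i x - g i y|) :=
      (tendsto_const_nhds.sub (((LipLoc.continuous (g i)).tendsto y).comp hlim)).abs
    refine le_of_tendsto_of_tendsto h2 (h1.const_mul _) ?_
    filter_upwards [h1.eventually (gt_mem_nhds hxy)] with n hn
    exact (hu n).2 i x hx hn
  have hSm : ∀ m, MeasurableSet (S m) := fun m => by
    rw [hS m]; exact hA.inter isClosed_closure.measurableSet
  have hcov : ∀ y ∈ A, ∃ m, y ∈ S m := by
    intro y hy
    have h1 : ∀ᶠ x in 𝓝[A] y, ∀ i, |g i x - g i y| ≤ L i * dist x y :=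
      eventually_all.2 fun i => hg i y hy
    obtain ⟨δ, hδ, hd⟩ := Metric.mem_nhdsWithin_iff.1 h1
    obtain ⟨m, hm⟩ := exists_nat_one_div_lt hδ
    exact ⟨m, hy, fun i x hx hxy => hd ⟨hxy.trans hm, hx⟩ i⟩
  let d := TopologicalSpace.denseSeq X
  -- Two points of a ball of radius r m / 2 are closer than r m, so on such a piece of S m the
  -- pointwise bound is a genuine Lipschitz bound.
  let Q : ℕ → Set X := fun n =>
    S n.unpair.1 ∩ Metric.ball (d n.unpair.2) (r n.unpair.1 / 2)
  refine hE.abs_apply_le_of_cover hT β g (Q := Q)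
    (fun n => (hSm _).inter Metric.isOpen_ball.measurableSet) (fun x hx => ?_)
    (Finset.prod_nonneg fun i _ => NNReal.coe_nonneg _) fun n γ hγ => ?_
  · refine hβ x fun hxA => hx ?_
    obtain ⟨m, hm⟩ := hcov x hxA
    obtain ⟨l, hl⟩ := (TopologicalSpace.denseRange_denseSeq X).exists_mem_open
      (Metric.isOpen_ball (x := x) (ε := r m / 2)) ⟨x, Metric.mem_ball_self (half_pos (hr m))⟩
    refine mem_iUnion.2 ⟨Nat.pair m l, ?_⟩
    simp only [Q, Nat.unpair_pair]
    exact ⟨hm, Metric.mem_ball_comm.1 hl⟩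
  · refine hE.abs_apply_le hT γ g hγ fun i => LipschitzOnWith.of_dist_le_mul fun x hx y hy => ?_
    rw [Real.dist_eq]
    refine hy.1.2 i x hx.1.1 ?_
    have h1 := Metric.mem_ball.1 hx.2
    have h2 := Metric.mem_ball'.1 hy.2
    linarith [dist_triangle x (d n.unpair.2) y]

/-- `T'(β, ·)` is alternating. -/
lemma IsCanonicalExtension.apply_eq_zero_of_eq (hE : IsCanonicalExtension T T')
    (hT : IsMetricCurrent T) (β : BorelC X) (g : Fin k → LipLoc X) {i j : Fin k}
    (hg : g i = g j) (hij : i ≠ j) : T' β g = 0 := by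
  have hN : ∀ n : ℕ, (0 : ℝ) < (n : ℝ) + 1 := fun n => by positivity
  set u := g i with hu
  -- The two equal arguments u are perturbed in opposite directions, so that at every point one of
  -- them is locked to a multiple of 1 / (n + 1).
  let G : ℕ → Fin k → LipLoc X := fun n =>
    Function.update (Function.update g i (LipLoc.comp (lipschitzWith_sub_distInt (hN n)) u)) j
      (LipLoc.comp (lipschitzWith_add_distInt (hN n)) u)
  have hGi : ∀ n x, G n i x = u x - distInt (((n : ℝ) + 1) * u x) / ((n : ℝ) + 1) := fun n x => by
    simp [G, Function.update_of_ne hij]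
  have hGj : ∀ n x, G n j x = u x + distInt (((n : ℝ) + 1) * u x) / ((n : ℝ) + 1) := fun n x => by
    simp [G]
  have hconv := hE.tendsto_of_converges hT β (g := G) (g' := g) fun l => by
    by_cases hl : l = j
    · subst hl
      simp only [G, Function.update_self]
      rw [← hg]
      refine LipLoc.converges_comp u _ fun t => ?_
      simpa using (tendsto_distInt_mul_div t).const_add t
    · by_cases hl' : l = i
      · subst hl'
        simp only [G, Function.update_of_ne hl, Function.update_self]
        refine LipLoc.converges_comp u _ fun t => ?_
        simpa using (tendsto_distInt_mul_div t).const_sub t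
      · simp only [G, Function.update_of_ne hl, Function.update_of_ne hl']
        exact LipLoc.converges_const _
  refine tendsto_nhds_unique hconv (tendsto_const_nhds.congr fun n => ?_)
  have hum : Measurable fun x => ((n : ℝ) + 1) * u x :=
    (LipLoc.continuous u).measurable.const_mul _
  have hround : Measurable fun x => round (((n : ℝ) + 1) * u x) := by
    simp only [round_eq]
    exact Int.measurable_floor.comp (hum.add_const _)
  -- Cells by the nearest integer and by the side of it. Slot i is constant on the upper halves and
  -- slot j on the lower ones, so strict locality gives the cover estimate with constant 0.
  let R : ℤ × Bool → Set X := fun p =>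
    {x | round (((n : ℝ) + 1) * u x) = p.1} ∩
      bif p.2 then {x | (p.1 : ℝ) ≤ ((n : ℝ) + 1) * u x} else {x | ((n : ℝ) + 1) * u x ≤ p.1}
  obtain ⟨e, he⟩ := exists_surjective_nat (ℤ × Bool)
  have hR : ∀ p, MeasurableSet (R p) := by
    rintro ⟨m, b⟩
    refine (hround (measurableSet_singleton m)).inter ?_
    cases b
    · exact measurableSet_le hum measurable_const
    · exact measurableSet_le measurable_const hum
  have hle := hE.abs_apply_le_of_cover hT β (G n) (Q := fun l => R (e l)) (fun l => hR _)
    (fun x hx => by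
      exfalso
      apply hx
      rcases le_total ((round (((n : ℝ) + 1) * u x) : ℤ) : ℝ) (((n : ℝ) + 1) * u x) with h | h
      · obtain ⟨l, hl⟩ := he (round (((n : ℝ) + 1) * u x), true)
        refine mem_iUnion.2 ⟨l, ?_⟩
        simp only [hl, R]
        exact ⟨rfl, h⟩
      · obtain ⟨l, hl⟩ := he (round (((n : ℝ) + 1) * u x), false)
        refine mem_iUnion.2 ⟨l, ?_⟩
        simp only [hl, R]
        exact ⟨rfl, h⟩) le_rfl (fun l γ hγ => by
      rw [zero_mul, abs_nonpos_iff]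
      rcases hp : e l with ⟨m, b⟩
      have hn1 : ((n : ℝ) + 1) ≠ 0 := (hN n).ne'
      cases b
      · refine hE.apply_eq_zero_of_const hT γ (G n) hγ j (c := m / ((n : ℝ) + 1)) fun x hx => ?_
        rw [hp] at hx
        obtain ⟨h1, h2⟩ := hx
        simp only [cond_false, mem_ofPred_eq] at h1 h2
        rw [hGj, distInt, h1, abs_of_nonpos (by linarith)]
        field_simp
        ring
      · refine hE.apply_eq_zero_of_const hT γ (G n) hγ i (c := m / ((n : ℝ) + 1)) fun x hx => ?_
        rw [hp] at hx
        obtain ⟨h1, h2⟩ := hx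
        simp only [cond_true, mem_ofPred_eq] at h1 h2
        rw [hGi, distInt, h1, abs_of_nonneg (by linarith)]
        field_simp
        ring)
  rw [zero_mul, abs_nonpos_iff] at hle
  exact hle.symm

lemma IsCanonicalExtension.apply_perm (hE : IsCanonicalExtension T T')
    (hT : IsMetricCurrent T) (β : BorelC X) (g : Fin k → LipLoc X) (σ : Equiv.Perm (Fin k)) :
    T' β (fun i => g (σ i)) = Equiv.Perm.sign σ * T' β g := by
  let M : AlternatingMap ℝ (LipLoc X) ℝ (Fin k) :=
    { T' β with
      map_eq_zero_of_eq' := fun g _ _ h hij => hE.apply_eq_zero_of_eq hT β g h hij }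
  have := M.map_perm g σ
  rw [Units.smul_def, zsmul_eq_mul] at this
  exact this

end Extension

/-! ### Integral representation of functionals bounded by an L¹ norm. -/

section Density

variable {X : Type*} [MetricSpace X] [MeasurableSpace X] [BorelSpace X]

/-- The restriction of a bounded measurable function to a compact set, as an element of `B_c(X)`. -/
def BorelC.ofBounded {K : Set X} (hK : IsCompact K) {u : X → ℝ} (hu : Measurable u) {C : ℝ}
    (hC : ∀ x, |u x| ≤ C) : BorelC X :=
  ⟨K.indicator u, hu.indicator hK.measurableSet, ⟨C, fun x => by
    by_cases hx : x ∈ K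
    · simpa [hx] using hC x
    · simpa [hx] using (abs_nonneg _).trans (hC x)⟩,
    HasCompactSupport.intro hK fun x hx => indicator_of_notMem hx _⟩

@[simp]
lemma BorelC.ofBounded_apply {K : Set X} (hK : IsCompact K) {u : X → ℝ} (hu : Measurable u) {C : ℝ}
    (hC : ∀ x, |u x| ≤ C) (x : X) : BorelC.ofBounded hK hu hC x = K.indicator u x := rfl

/-- The characteristic function of a compact set. -/
def BorelC.char {K : Set X} (hK : IsCompact K) : BorelC X :=
  BorelC.ofBounded hK (u := fun _ => 1) measurable_const (C := 1) (by simp)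

@[simp]
lemma BorelC.char_apply {K : Set X} (hK : IsCompact K) (x : X) :
    BorelC.char hK x = K.indicator (fun _ => 1) x := rfl

lemma BorelC.integrable_mul {μ : Measure X} (β : BorelC X) {K : Set X} (hK : IsCompact K)
    (hβ : ∀ x ∉ K, β x = 0) {h : X → ℝ} (hh : IntegrableOn h K μ) :
    Integrable (fun x => β x * h x) μ := by
  obtain ⟨C, hC⟩ := β.2.2.1
  have h1 : Integrable (fun x => β x * K.indicator h x) μ :=
    ((integrable_indicator_iff hK.measurableSet).2 hh).bdd_mul (c := C)
      (BorelC.measurable β).aestronglyMeasurable (Eventually.of_forall hC)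
  refine h1.congr (Eventually.of_forall fun x => ?_)
  by_cases hx : x ∈ K
  · simp [hx]
  · simp [hx, hβ x hx]

variable {ν : Measure X} [ν.Regular]

omit [BorelSpace X] in
-- For β ≥ 0 and disjoint sets the remainder is itself a nonnegative function, so its L¹ norm is a
-- difference of integrals. This is the tail bound behind the countable additivity of A ↦ Λ(χ_A β).
lemma BorelC.abs_sub_sum_indicator_le {Λ : BorelC X →ₗ[ℝ] ℝ} {K : Set X} {C : ℝ}
    (hΛ : ∀ β : BorelC X, (∀ x ∉ K, β x = 0) → |Λ β| ≤ C * ∫ x, |β x| ∂ν)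
    {β : BorelC X} (hβ : ∀ x ∉ K, β x = 0) (hβ0 : ∀ x, 0 ≤ β x) {A : ℕ → Set X}
    (hA : ∀ n, MeasurableSet (A n)) (hd : Pairwise (Function.onFun Disjoint A)) (t : Finset ℕ) :
    |Λ (BorelC.indicator (MeasurableSet.iUnion hA) β) - ∑ n ∈ t, Λ (BorelC.indicator (hA n) β)| ≤
      C * (∫ x in ⋃ n, A n, β x ∂ν - ∑ n ∈ t, ∫ x in A n, β x ∂ν) := by
  set γ : BorelC X := BorelC.indicator (MeasurableSet.iUnion hA) β -
    ∑ n ∈ t, BorelC.indicator (hA n) β with hγ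
  have hγx : ∀ x, γ x = (⋃ n, A n).indicator β x - ∑ n ∈ t, (A n).indicator β x := fun x => by
    simp [hγ]
  have hnn : ∀ x, 0 ≤ γ x := by
    intro x
    rw [hγx, sub_nonneg, ← Finset.indicator_biUnion_apply _ _ fun i _ j _ hij => hd hij]
    exact indicator_le_indicator_of_subset
      (iUnion₂_subset fun i _ => subset_iUnion A i) hβ0 x
  have h1 := hΛ γ fun x hx => by
    have h0 : ∀ S : Set X, S.indicator β x = 0 := fun S => by
      by_cases hxS : x ∈ S <;> simp [hxS, hβ x hx]
    rw [hγx]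
    simp [h0]
  have h2 : ∫ x, |γ x| ∂ν = ∫ x in ⋃ n, A n, β x ∂ν - ∑ n ∈ t, ∫ x in A n, β x ∂ν := by
    simp_rw [abs_of_nonneg (hnn _), hγx]
    have hi : ∀ n, Integrable ((A n).indicator β) ν := fun n =>
      (BorelC.integrable β).indicator (hA n)
    rw [integral_sub ((BorelC.integrable β).indicator (MeasurableSet.iUnion hA))
      (integrable_finsetSum _ fun n _ => hi n), integral_finsetSum _ fun n _ => hi n,
      integral_indicator (MeasurableSet.iUnion hA)]
    simp_rw [integral_indicator (hA _)]
  rw [h2, hγ, map_sub, map_sum] at h1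
  exact h1

/-- The set function A ↦ Λ(χ_{A ∩ K}) is a signed measure, absolutely continuous with respect to μ
because ν is. Its Radon–Nikodym derivative represents Λ on simple functions by linearity, and on
bounded Borel functions by dominated convergence on both sides: under ν for Λ, under μ for the
integral. -/
lemma exists_density_on_compact {μ : Measure X} [SigmaFinite μ] (hac : ν ≪ μ)
    (Λ : BorelC X →ₗ[ℝ] ℝ) {K : Set X} (hK : IsCompact K) {C : ℝ}
    (hΛ : ∀ β : BorelC X, (∀ x ∉ K, β x = 0) → |Λ β| ≤ C * ∫ x, |β x| ∂ν) :
    ∃ h : X → ℝ, Measurable h ∧ Integrable h μ ∧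
      ∀ β : BorelC X, (∀ x ∉ K, β x = 0) → Λ β = ∫ x, β x * h x ∂μ := by
  classical
  have hχ : ∀ x ∉ K, BorelC.char hK x = 0 := fun x hx => by simp [hx]
  have hχ0 : ∀ x, 0 ≤ BorelC.char hK x := fun x =>
    indicator_nonneg (fun _ _ => zero_le_one) x
  have hχi : Integrable (BorelC.char hK) ν := BorelC.integrable _
  let s : SignedMeasure X :=
    { measureOf' := fun A => if hA : MeasurableSet A then
        Λ (BorelC.indicator hA (BorelC.char hK)) else 0
      empty' := by
        have : BorelC.indicator MeasurableSet.empty (BorelC.char hK) = 0 := by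
          ext x; simp
        rw [dif_pos MeasurableSet.empty, this, map_zero]
      not_measurable' := fun A hA => dif_neg hA
      m_iUnion' := by
        intro A hA hd
        rw [dif_pos (MeasurableSet.iUnion hA)]
        simp_rw [dif_pos (hA _)]
        have h1 := hasSum_integral_iUnion hA hd hχi.integrableOn
        have h2 : Tendsto (fun t : Finset ℕ => C * (∫ x in ⋃ n, A n, BorelC.char hK x ∂ν -
            ∑ n ∈ t, ∫ x in A n, BorelC.char hK x ∂ν)) atTop (𝓝 0) := by
          have := (Tendsto.const_sub (∫ x in ⋃ n, A n, BorelC.char hK x ∂ν) h1).const_mul C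
          simpa using this
        have h3 : Tendsto (fun t : Finset ℕ =>
            Λ (BorelC.indicator (MeasurableSet.iUnion hA) (BorelC.char hK)) -
              ∑ n ∈ t, Λ (BorelC.indicator (hA n) (BorelC.char hK))) atTop (𝓝 0) :=
          squeeze_zero_norm (fun t => BorelC.abs_sub_sum_indicator_le hΛ hχ hχ0 hA hd t) h2
        have h4 := h3.const_sub (Λ (BorelC.indicator (MeasurableSet.iUnion hA) (BorelC.char hK)))
        rw [HasSum, SummationFilter.unconditional_filter]
        simpa using h4 }
  have hs : ∀ {A : Set X} (hA : MeasurableSet A),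
      s A = Λ (BorelC.indicator hA (BorelC.char hK)) := fun hA => dif_pos hA
  have hsac : s ≪ᵥ μ.toENNRealVectorMeasure := by
    refine VectorMeasure.AbsolutelyContinuous.mk fun A hA h0 => ?_
    rw [Measure.toENNRealVectorMeasure_apply_measurable hA] at h0
    have h1 := hΛ (BorelC.indicator hA (BorelC.char hK)) fun x hx => by simp [hx]
    have h2 : ∫ x, |BorelC.indicator hA (BorelC.char hK) x| ∂ν = 0 := by
      refine integral_eq_zero_of_ae ?_
      filter_upwards [measure_eq_zero_iff_ae_notMem.1 (hac h0)] with x hx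
      simp [hx]
    rw [h2, mul_zero, abs_nonpos_iff] at h1
    rw [hs hA, h1]
  have hh : Integrable (s.rnDeriv μ) μ := SignedMeasure.integrable_rnDeriv s μ
  have hset : ∀ {A : Set X} (hA : MeasurableSet A),
      Λ (BorelC.indicator hA (BorelC.char hK)) = ∫ x in A, s.rnDeriv μ x ∂μ := by
    intro A hA
    rw [← hs hA, ← withDensityᵥ_apply hh hA, SignedMeasure.withDensityᵥ_rnDeriv_eq s μ hsac]
  refine ⟨s.rnDeriv μ, SignedMeasure.measurable_rnDeriv s μ, hh, ?_⟩
  set h := s.rnDeriv μ with hdef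
  have hmul : ∀ γ : BorelC X, (∀ x ∉ K, γ x = 0) → Integrable (fun x => γ x * h x) μ :=
    fun γ hγ => BorelC.integrable_mul γ hK hγ hh.integrableOn
  have hbd : ∀ φ : SimpleFunc X ℝ, ∃ B : ℝ, ∀ x, |φ x| ≤ B := fun φ => φ.exists_forall_norm_le
  choose B hB using hbd
  let q : SimpleFunc X ℝ → BorelC X := fun φ => BorelC.ofBounded hK φ.measurable (hB φ)
  have hqx : ∀ φ x, q φ x = K.indicator φ x := fun φ x => rfl
  have hqK : ∀ φ, ∀ x ∉ K, q φ x = 0 := fun φ x hx => by simp [hqx, hx]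
  have hsimple : ∀ φ : SimpleFunc X ℝ, Λ (q φ) = ∫ x, q φ x * h x ∂μ := by
    intro φ
    induction φ using SimpleFunc.induction with
    | const c hA =>
      rename_i A
      have h1 : q (SimpleFunc.piecewise A hA (SimpleFunc.const _ c) (SimpleFunc.const _ 0)) =
          c • BorelC.indicator (hA.inter hK.measurableSet) (BorelC.char hK) := by
        ext x
        show K.indicator _ x = c * _
        by_cases hx : x ∈ K <;> by_cases hxA : x ∈ A <;> simp [hx, hxA]
      rw [h1, map_smul, hset, ← integral_indicator (hA.inter hK.measurableSet), smul_eq_mul,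
        ← integral_const_mul]
      refine integral_congr_ae (Eventually.of_forall fun x => ?_)
      show _ = c * (A ∩ K).indicator (BorelC.char hK) x * h x
      by_cases hx : x ∈ K <;> by_cases hxA : x ∈ A <;> simp [hx, hxA]
    | add hd h1 h2 =>
      rename_i φ φ'
      have h3 : q (φ + φ') = q φ + q φ' := by
        ext x
        show q (φ + φ') x = q φ x + q φ' x
        rw [hqx, hqx, hqx]
        by_cases hx : x ∈ K <;> simp [hx]
      rw [h3, map_add, h1, h2, ← integral_add (hmul _ (hqK _)) (hmul _ (hqK _))]
      refine integral_congr_ae (Eventually.of_forall fun x => ?_)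
      show _ = (q φ x + q φ' x) * h x
      ring
  intro β hβ
  let φ : ℕ → SimpleFunc X ℝ := SimpleFunc.approxOn β (BorelC.measurable β) univ 0 (mem_univ _)
  have hφ1 : ∀ x, Tendsto (fun n => φ n x) atTop (𝓝 (β x)) := fun x =>
    SimpleFunc.tendsto_approxOn _ _ (by simp)
  have hφ2 : ∀ n x, |φ n x| ≤ |β x| + |β x| := fun n x =>
    SimpleFunc.norm_approxOn_zero_le (BorelC.measurable β) (mem_univ _) x n
  have hqφ : ∀ n x, q (φ n) x = φ n x := fun n x => by
    rw [hqx]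
    by_cases hx : x ∈ K
    · simp [hx]
    · have := hφ2 n x
      rw [hβ x hx] at this
      simp only [abs_zero, add_zero, abs_nonpos_iff] at this
      simp [hx, this]
  have hlim1 : Tendsto (fun n => Λ (q (φ n))) atTop (𝓝 (Λ β)) := by
    rw [tendsto_iff_norm_sub_tendsto_zero]
    have h0 : Tendsto (fun n => ∫ x, |q (φ n) x - β x| ∂ν) atTop (𝓝 (∫ x : X, (0 : ℝ) ∂ν)) := by
      refine tendsto_integral_of_dominated_convergence (fun x => |β x| + |β x| + |β x|)
        (fun n => ((BorelC.measurable _).sub (BorelC.measurable β)).abs.aestronglyMeasurable)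
        (((BorelC.integrable β).abs.add (BorelC.integrable β).abs).add (BorelC.integrable β).abs)
        (fun n => Eventually.of_forall fun x => ?_) (Eventually.of_forall fun x => ?_)
      · rw [hqφ, Real.norm_eq_abs, abs_abs]
        exact (abs_sub _ _).trans (add_le_add (hφ2 n x) le_rfl)
      · simp_rw [hqφ]
        simpa using ((hφ1 x).sub_const (β x)).abs
    have h2 := h0.const_mul C
    rw [integral_zero, mul_zero] at h2
    refine squeeze_zero (fun n => norm_nonneg _) (fun n => ?_) h2
    rw [← map_sub]
    refine hΛ _ fun x hx => ?_
    show q (φ n) x - β x = 0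
    rw [hqK _ x hx, hβ x hx, sub_zero]
  refine tendsto_nhds_unique hlim1 ?_
  simp_rw [hsimple]
  refine tendsto_integral_of_dominated_convergence (fun x => |β x * h x| + |β x * h x|)
    (fun n => (hmul _ (hqK _)).aestronglyMeasurable) ((hmul β hβ).abs.add (hmul β hβ).abs)
    (fun n => Eventually.of_forall fun x => ?_) (Eventually.of_forall fun x => ?_)
  · rw [hqφ, Real.norm_eq_abs, abs_mul, abs_mul, ← add_mul]
    exact mul_le_mul_of_nonneg_right (hφ2 n x) (abs_nonneg _)
  · simp_rw [hqφ]
    exact (hφ1 x).mul_const _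

/-- A functional on `B_c(X)` which is locally bounded by the `L¹(ν)`-norm, where `ν ≪ μ`, is the
integration against a function which is `μ`-integrable on compact sets. -/
lemma exists_density [LocallyCompactSpace X] [SecondCountableTopology X]
    {μ : Measure X} [SigmaFinite μ] (hac : ν ≪ μ) (Λ : BorelC X →ₗ[ℝ] ℝ)
    (hΛ : ∀ K : Set X, IsCompact K → ∃ C : ℝ, ∀ β : BorelC X, (∀ x ∉ K, β x = 0) →
      |Λ β| ≤ C * ∫ x, |β x| ∂ν) :
    ∃ h : X → ℝ, (∀ K : Set X, IsCompact K → IntegrableOn h K μ) ∧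
      ∀ β : BorelC X, Λ β = ∫ x, β x * h x ∂μ := by
  let K : CompactExhaustion X := default
  choose C hC using fun n => hΛ (K n) (K.isCompact n)
  choose u hum hui hu using fun n => exists_density_on_compact hac Λ (K.isCompact n) (hC n)
  have hEm : ∀ n, MeasurableSet (disjointed K n) := fun n =>
    MeasurableSet.disjointed (fun i => (K.isCompact i).measurableSet) n
  -- The densities found on the compact sets are glued along disjoint shells, so no compatibility
  -- between them is needed.
  obtain ⟨h, hm, hh⟩ := exists_measurable_piecewise (disjointed K) hEm u hum fun i j hij x hx =>
    ((disjoint_disjointed K hij).le_bot hx).elim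
  have hcover : ∀ n x, x ∈ K n → ∃ m ∈ Finset.range (n + 1), x ∈ disjointed K m := by
    intro n x hx
    have h1 : x ∈ partialSups (disjointed K) n := by
      rw [partialSups_disjointed]
      exact le_partialSups K n hx
    rw [partialSups_eq_biUnion_range] at h1
    simpa using h1
  have hloc : ∀ n, IntegrableOn h (K n) μ := by
    intro n
    have h1 : IntegrableOn h (⋃ m ∈ Finset.range (n + 1), disjointed K m) μ := by
      rw [integrableOn_finset_iUnion]
      intro m _
      exact (hui m).integrableOn.congr_fun (fun x hx => (hh m hx).symm) (hEm m)
    refine h1.mono_set fun x hx => ?_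
    obtain ⟨m, hm, hxm⟩ := hcover n x hx
    exact mem_biUnion hm hxm
  refine ⟨h, fun L hL => ?_, fun β => ?_⟩
  · obtain ⟨n, hn⟩ := K.exists_superset_of_isCompact hL
    exact (hloc n).mono_set hn
  · obtain ⟨n, hn⟩ := K.exists_superset_of_isCompact (BorelC.isCompact_tsupport β)
    have hβK : ∀ x ∉ K n, β x = 0 := fun x hx =>
      image_eq_zero_of_notMem_tsupport fun h' => hx (hn h')
    have hsumx : ∀ x, β x = ∑ m ∈ Finset.range (n + 1), (disjointed K m).indicator β x := by
      intro x
      rw [← Finset.indicator_biUnion_apply _ _ fun i _ j _ hij => disjoint_disjointed K hij]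
      by_cases hx : x ∈ K n
      · obtain ⟨m, hm, hxm⟩ := hcover n x hx
        exact (indicator_of_mem (mem_iUnion₂.2 ⟨m, hm, hxm⟩) _).symm
      · exact (indicator_apply_eq_zero.2 fun _ => hβK x hx).symm ▸ hβK x hx
    have hsum : β = ∑ m ∈ Finset.range (n + 1), BorelC.indicator (hEm m) β := by
      ext x
      rw [hsumx x]
      simp
    have hpiece : ∀ m, Λ (BorelC.indicator (hEm m) β) =
        ∫ x, (disjointed K m).indicator β x * h x ∂μ := by
      intro m
      rw [hu m _ fun x hx => indicator_of_notMem (fun h' => hx (disjointed_subset K m h')) _]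
      refine integral_congr_ae (Eventually.of_forall fun x => ?_)
      by_cases hx : x ∈ disjointed K m
      · simp [hx, hh m hx]
      · simp [hx]
    conv_lhs => rw [hsum]
    rw [map_sum]
    simp_rw [hpiece]
    rw [← integral_finsetSum]
    · refine integral_congr_ae (Eventually.of_forall fun x => ?_)
      simp only
      rw [← Finset.sum_mul, ← hsumx]
    · intro m _
      refine BorelC.integrable_mul (BorelC.indicator (hEm m) β) (K.isCompact n) (fun x hx => ?_)
        (hloc n)
      simp [hβK x hx]

/-- A bound of the functional `β ↦ ∫ β h dμ` by the `L¹(ν)`-norm, where `ν ≪ μ`, gives a pointwise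
bound of `h`. -/
lemma ae_abs_le_of_forall_abs_integral_le {μ : Measure X} [SigmaFinite μ] [SigmaFinite ν]
    (hac : ν ≪ μ) {h : X → ℝ} {K A : Set X} (hK : IsCompact K) (hA : MeasurableSet A) (hAK : A ⊆ K)
    (hh : IntegrableOn h K μ) {C : ℝ}
    (hC : ∀ β : BorelC X, (∀ x ∉ A, β x = 0) → |∫ x, β x * h x ∂μ| ≤ C * ∫ x, |β x| ∂ν) :
    ∀ᵐ x ∂(μ.restrict A), |h x| ≤ C * (ν.rnDeriv μ x).toReal := by
  have hi1 : Integrable h (μ.restrict A) := hh.mono_set hAK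
  have hi2 : Integrable (fun x => C * (ν.rnDeriv μ x).toReal) (μ.restrict A) :=
    ((Measure.integrableOn_toReal_rnDeriv hK.measure_lt_top.ne).mono_set hAK).const_mul C
  -- Testing with the characteristic function of S ∩ A compares the integrals of h and C dν/dμ over
  -- arbitrary sets; the comparison for h and for -h gives the pointwise bound.
  have key : ∀ S, MeasurableSet S → |∫ x in S, h x ∂(μ.restrict A)| ≤
      ∫ x in S, C * (ν.rnDeriv μ x).toReal ∂(μ.restrict A) := by
    intro S hS
    have hSA := hS.inter hA
    rw [Measure.restrict_restrict hS, integral_const_mul,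
      Measure.setIntegral_toReal_rnDeriv hac, ← integral_indicator_one hSA,
      ← integral_indicator hSA]
    have hval : ∀ x, BorelC.indicator hSA (BorelC.char hK) x = (S ∩ A).indicator 1 x := fun x => by
      by_cases hx : x ∈ S ∩ A
      · simp [hx, hAK hx.2]
      · rw [BorelC.indicator_apply, indicator_of_notMem hx, indicator_of_notMem hx]
    have := hC (BorelC.indicator hSA (BorelC.char hK)) fun x hx =>
      indicator_of_notMem (fun h' => hx h'.2) _
    simp only [hval] at this
    have habs : ∀ x, |(S ∩ A).indicator (1 : X → ℝ) x| = (S ∩ A).indicator (1 : X → ℝ) x :=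
      fun x => abs_of_nonneg (indicator_nonneg (fun _ _ => zero_le_one) x)
    simp only [habs] at this
    convert this using 2
    refine integral_congr_ae (Eventually.of_forall fun x => ?_)
    by_cases hx : x ∈ S ∩ A <;> simp only [indicator, hx] <;> simp
  have h1 := ae_le_of_forall_setIntegral_le hi1 hi2 fun S hS _ =>
    (le_abs_self _).trans (key S hS)
  have h2 := ae_le_of_forall_setIntegral_le hi1.neg hi2 fun S hS _ => by
    refine le_trans ?_ (key S hS)
    simp only [Pi.neg_apply, integral_neg]
    exact neg_le_abs _
  filter_upwards [h1, h2] with x hx1 hx2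
  exact abs_le.2 ⟨by simp only [Pi.neg_apply] at hx2; linarith, hx1⟩

end Density

/-! ### Differentials along a chart. -/

section Differentials

variable {X : Type*} [MetricSpace X] {n : ℕ} {Y : Set X} {π : X → EuclideanSpace ℝ (Fin n)}

lemma chartDiff_eq {f : X → ℝ} {y : X} {D : EuclideanSpace ℝ (Fin n) →L[ℝ] ℝ}
    (h : ∃! D, HasChartDiffAt Y π f y D) (hD : HasChartDiffAt Y π f y D) :
    chartDiff Y π f y = D := by
  rw [chartDiff, dif_pos h]
  exact h.unique h.choose_spec.1 hD

lemma hasChartDiffAt_chartDiff {f : X → ℝ} {y : X} (h : ∃! D, HasChartDiffAt Y π f y D) :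
    HasChartDiffAt Y π f y (chartDiff Y π f y) := by
  rw [chartDiff, dif_pos h]
  exact h.choose_spec.1

lemma HasChartDiffAt.congr {f f' : X → ℝ} {y : X} {D : EuclideanSpace ℝ (Fin n) →L[ℝ] ℝ}
    (h : HasChartDiffAt Y π f y D) (hf : f =ᶠ[𝓝 y] f') : HasChartDiffAt Y π f' y D := by
  refine h.congr' ?_ EventuallyEq.rfl
  filter_upwards [nhdsWithin_le_nhds hf] with x hx
  rw [hx, hf.eq_of_nhds]

lemma hasChartDiffAt_congr {f f' : X → ℝ} {y : X} (hf : f =ᶠ[𝓝 y] f')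
    (D : EuclideanSpace ℝ (Fin n) →L[ℝ] ℝ) :
    HasChartDiffAt Y π f y D ↔ HasChartDiffAt Y π f' y D :=
  ⟨fun h => h.congr hf, fun h => h.congr hf.symm⟩

lemma hasChartDiffAt_proj {f : X → ℝ} {j : Fin n} (hf : ∀ x ∈ Y, f x = π x j) {y : X} (hy : y ∈ Y) :
    HasChartDiffAt Y π f y (EuclideanSpace.proj j) := by
  refine Asymptotics.IsLittleO.congr' (Asymptotics.isLittleO_zero _ _) ?_ EventuallyEq.rfl
  filter_upwards [self_mem_nhdsWithin] with x hx
  simp [hf x hx, hf y hy]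

lemma dual_apply_eq_sum (D : EuclideanSpace ℝ (Fin n) →L[ℝ] ℝ) (v : EuclideanSpace ℝ (Fin n)) :
    D v = ∑ j, D (EuclideanSpace.single j 1) * v j := by
  conv_lhs => rw [← (EuclideanSpace.basisFun (Fin n) ℝ).sum_repr v]
  simp [mul_comm]

/-- Subtracting the frozen linear part c ∘ π leaves (D - c)(π x - π y), of size at most ‖D - c‖ C
dist x y, and an o(dist x y) term that the strict inequality for r absorbs. -/
lemma HasChartDiffAt.eventually_abs_sub_le {f : X → ℝ} {y : X} (hy : y ∈ Y)
    {D c : EuclideanSpace ℝ (Fin n) →L[ℝ] ℝ} (h : HasChartDiffAt Y π f y D) {C : ℝ≥0}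
    (hπ : LipschitzOnWith C π Y) {p : Fin n → X → ℝ} (hp : ∀ j, ∀ x ∈ Y, p j x = π x j) {r : ℝ}
    (hr : ‖D - c‖ * C < r) :
    ∀ᶠ x in 𝓝[Y] y, |(f x - ∑ j, c (EuclideanSpace.single j 1) * p j x) -
      (f y - ∑ j, c (EuclideanSpace.single j 1) * p j y)| ≤ r * dist x y := by
  have h1 := Asymptotics.IsLittleO.def h (sub_pos.2 hr)
  filter_upwards [h1, self_mem_nhdsWithin] with x hx hxY
  have hc : ∀ z ∈ Y, ∑ j, c (EuclideanSpace.single j 1) * p j z = c (π z) := fun z hz => by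
    rw [dual_apply_eq_sum c (π z)]
    exact Finset.sum_congr rfl fun j _ => by rw [hp j z hz]
  rw [hc x hxY, hc y hy]
  have h2 : f x - c (π x) - (f y - c (π y)) =
      (f x - f y - D (π x - π y)) + (D - c) (π x - π y) := by
    simp only [map_sub, sub_apply]
    ring
  have h3 : |(D - c) (π x - π y)| ≤ ‖D - c‖ * C * dist x y := by
    refine ((D - c).le_opNorm _).trans ?_
    rw [mul_assoc, ← dist_eq_norm (π x)]
    exact mul_le_mul_of_nonneg_left (hπ.dist_le_mul x hxY y hy) (norm_nonneg _)
  rw [Real.norm_eq_abs, Real.norm_of_nonneg dist_nonneg] at hx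
  rw [h2]
  refine (abs_add_le _ _).trans ?_
  linarith

/-- The map π is controlled on Y only; its components are extended to X so that they can serve as
arguments of T'. -/
lemma exists_coordinates {C : ℝ≥0} (hπ : LipschitzOnWith C π Y) :
    ∃ p : Fin n → LipLoc X, ∀ j, ∀ x ∈ Y, p j x = π x j := by
  have h : ∀ j, LipschitzOnWith C (fun x => π x j) Y := fun j =>
    LipschitzOnWith.of_dist_le_mul fun x hx y hy => by
      refine le_trans ?_ (hπ.dist_le_mul x hx y hy)
      rw [dist_eq_norm, dist_eq_norm]
      exact PiLp.norm_apply_le (π x - π y) j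
  choose p hp hp' using fun j => (h j).extend_real
  exact ⟨fun j => LipLoc.ofLipschitz (hp j), fun j x hx => (hp' j hx).symm⟩

variable [MeasurableSpace X] [BorelSpace X] {μ : Measure X}

/-- A coordinate patch provides uniqueness of the measurable function D, not of its values. Changing
D at a single point keeps it measurable, so a second differential at that point would contradict
uniqueness of D. -/
lemma IsCoordinatePatch.ae_existsUnique_of_lipschitz (h : IsCoordinatePatch μ Y π) {f : X → ℝ}
    (hf : ∃ C : ℝ≥0, LipschitzWith C f) :
    (∀ᵐ y ∂(μ.restrict Y), ∃! D, HasChartDiffAt Y π f y D) ∧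
      AEMeasurable (chartDiff Y π f) (μ.restrict Y) := by
  classical
  obtain ⟨Yf, hYf, hnull, D, ⟨hDm, hD⟩, hDu⟩ := h.differentiable f hf
  have huniq : ∀ y : Yf, ∃! D, HasChartDiffAt Y π f y D := by
    intro y
    refine ⟨D y, hD y, fun D' hD' => ?_⟩
    have h1 : Measurable fun z : Yf => if z = y then D' else D z :=
      Measurable.ite (measurableSet_singleton y) measurable_const hDm
    have h2 := hDu (fun z => if z = y then D' else D z) ⟨h1, fun z => by
      by_cases hz : z = y
      · subst hz; simpa using hD'
      · simpa [hz] using hD z⟩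
    simpa using congrFun h2 y
  have hYm := h.measurableSet
  refine ⟨?_, ?_⟩
  · rw [ae_restrict_iff' hYm]
    refine measure_mono_null (fun y hy => ?_) hnull
    by_contra h'
    refine hy fun hyY => ?_
    have hyf : y ∈ Yf := by
      by_contra hyf
      exact h' ⟨hyY, hyf⟩
    exact huniq ⟨y, hyf⟩
  -- Yf need not be measurable in X; discarding a measurable null set containing Y \ Yf leaves a
  -- measurable subset of Yf on which the differential is D.
  · set N := toMeasurable μ (Y \ Yf) with hN
    have hNm : MeasurableSet N := measurableSet_toMeasurable _ _
    have hN0 : μ N = 0 := by rw [hN, measure_toMeasurable, hnull]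
    have hZf : Y \ N ⊆ Yf := fun y hy => by
      by_contra hyf
      exact hy.2 (subset_toMeasurable _ _ ⟨hy.1, hyf⟩)
    have hZm : MeasurableSet (Y \ N) := hYm.diff hNm
    have h1 : Measurable fun z : ↥(Y \ N) => chartDiff Y π f z := by
      have : (fun z : ↥(Y \ N) => chartDiff Y π f z) = fun z => D (inclusion hZf z) := by
        ext1 z
        exact chartDiff_eq (huniq (inclusion hZf z)) (hD (inclusion hZf z))
      rw [this]
      exact hDm.comp (measurable_inclusion hZf)
    have h2 : μ.restrict Y = μ.restrict (Y \ N) :=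
      Measure.restrict_congr_set (sdiff_null_ae_eq_self hN0).symm
    rw [h2]
    exact aemeasurable_restrict_of_measurable_subtype hZm h1

variable [LocallyCompactSpace X] [SecondCountableTopology X]

/-- A locally Lipschitz function has a unique differential almost everywhere on a coordinate patch,
and this differential is measurable. -/
lemma IsCoordinatePatch.ae_existsUnique (h : IsCoordinatePatch μ Y π) (g : LipLoc X) :
    (∀ᵐ y ∂(μ.restrict Y), ∃! D, HasChartDiffAt Y π g y D) ∧
      AEMeasurable (chartDiff Y π g) (μ.restrict Y) := by
  let K : CompactExhaustion X := default
  choose C hC using fun m => LipLoc.exists_lipschitzOnWith g (K.isCompact m)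
  -- Differentials are local, and on the interior of K m the function g agrees with a globally
  -- Lipschitz one.
  choose u hu hgu using fun m => LipLoc.exists_extension g (hC m)
  have hnhds : ∀ m, ∀ y ∈ interior (K m), (u m : X → ℝ) =ᶠ[𝓝 y] g := fun m y hy => by
    filter_upwards [mem_interior_iff_mem_nhds.1 hy] with x hx
    exact (hgu m hx).symm
  have hiff : ∀ m, ∀ y ∈ interior (K m), (∃! D, HasChartDiffAt Y π (u m) y D) →
      (∃! D, HasChartDiffAt Y π g y D) ∧ chartDiff Y π (u m) y = chartDiff Y π g y := by
    intro m y hy hD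
    have h1 : ∃! D, HasChartDiffAt Y π g y D :=
      (existsUnique_congr fun D => hasChartDiffAt_congr (hnhds m y hy) D).1 hD
    exact ⟨h1, (chartDiff_eq h1 ((hasChartDiffAt_chartDiff hD).congr (hnhds m y hy))).symm⟩
  have hex : ∀ y, ∃ m, y ∈ interior (K m) := fun y => by
    obtain ⟨m, hm⟩ := K.exists_mem_nhds y
    exact ⟨m, mem_interior_iff_mem_nhds.2 hm⟩
  have hae : ∀ m, ∀ᵐ y ∂(μ.restrict Y), ∃! D, HasChartDiffAt Y π (u m) y D := fun m =>
    (h.ae_existsUnique_of_lipschitz ⟨_, hu m⟩).1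
  refine ⟨?_, ?_⟩
  · filter_upwards [ae_all_iff.2 hae] with y hy
    obtain ⟨m, hm⟩ := hex y
    exact (hiff m y hm (hy m)).1
  · have hU : ⋃ m, interior (K m) = univ := iUnion_eq_univ_iff.2 hex
    rw [← Measure.restrict_univ (μ := μ.restrict Y), ← hU, aemeasurable_iUnion_iff]
    intro m
    refine ((h.ae_existsUnique_of_lipschitz ⟨_, hu m⟩).2.mono_measure
      Measure.restrict_le_self).congr ?_
    rw [EventuallyEq, ae_restrict_iff' isOpen_interior.measurableSet]
    filter_upwards [hae m] with y hy hym
    exact (hiff m y hym hy).2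

end Differentials

/-! ### The chain rule for densities in one argument. -/

section ChainRule

variable {X : Type*} [MetricSpace X] [LocallyCompactSpace X] [SecondCountableTopology X]
  [MeasurableSpace X] [BorelSpace X] {μ : Measure X} [SigmaFinite μ]

lemma ae_eq_zero_of_forall_integral_eq_zero {ν : Measure X} [ν.Regular] (hac : ν ≪ μ) {h : X → ℝ}
    (hh : ∀ K : Set X, IsCompact K → IntegrableOn h K μ)
    (h0 : ∀ β : BorelC X, ∫ x, β x * h x ∂μ = 0) : ∀ᵐ x ∂μ, h x = 0 := by
  let K : CompactExhaustion X := default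
  have h1 : ∀ m, ∀ᵐ x ∂μ, x ∈ K m → h x = 0 := fun m => by
    have := ae_abs_le_of_forall_abs_integral_le hac (K.isCompact m)
      (K.isCompact m).measurableSet subset_rfl (hh _ (K.isCompact m)) (C := 0) fun β _ => by
        simp [h0 β]
    rw [ae_restrict_iff' (K.isCompact m).measurableSet] at this
    filter_upwards [this] with x hx hxK
    simpa using hx hxK
  filter_upwards [ae_all_iff.2 h1] with x hx
  obtain ⟨m, hm⟩ := K.exists_mem x
  exact hx m hm

variable {k : ℕ} {T : FormFunctional X k} [(mass T).Regular] {T' : MeasFormFunctional X k}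
  {n : ℕ} {Y : Set X} {π : X → EuclideanSpace ℝ (Fin n)}

lemma IsCanonicalExtension.exists_density (hE : IsCanonicalExtension T T')
    (hT : IsMetricCurrent T) (hac : mass T ≪ μ) :
    ∃ dens : (Fin k → LipLoc X) → X → ℝ,
      (∀ g, ∀ K : Set X, IsCompact K → IntegrableOn (dens g) K μ) ∧
      ∀ g β, T' β g = ∫ x, β x * dens g x ∂μ := by
  have h : ∀ g : Fin k → LipLoc X, ∃ h : X → ℝ,
      (∀ K : Set X, IsCompact K → IntegrableOn h K μ) ∧
      ∀ β : BorelC X, T' β g = ∫ x, β x * h x ∂μ := by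
    intro g
    let Λ : BorelC X →ₗ[ℝ] ℝ :=
      { toFun := fun β => T' β g
        map_add' := fun β γ => by rw [map_add, add_apply]
        map_smul' := fun c β => by rw [map_smul, smul_apply, RingHom.id_apply] }
    refine MetricCurrents.exists_density hac Λ fun K hK => ?_
    choose L hL using fun i => LipLoc.exists_lipschitzOnWith (g i) hK
    exact ⟨∏ i, (L i : ℝ), fun β hβ => hE.abs_apply_le hT β g hβ hL⟩
  choose dens h1 h2 using h
  exact ⟨dens, h1, h2⟩

variable {dens : (Fin k → LipLoc X) → X → ℝ}

/-- The chain rule in one argument, for the densities of `T'`. -/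
lemma IsCanonicalExtension.density_eq_sum_update (hE : IsCanonicalExtension T T')
    (hT : IsMetricCurrent T) (hac : mass T ≪ μ) (hY : IsCoordinatePatch μ Y π)
    (hd1 : ∀ g, ∀ K : Set X, IsCompact K → IntegrableOn (dens g) K μ)
    (hd2 : ∀ g β, T' β g = ∫ x, β x * dens g x ∂μ)
    {p : Fin n → LipLoc X} (hp : ∀ j, ∀ x ∈ Y, p j x = π x j) (g : Fin k → LipLoc X) (i : Fin k) :
    ∀ᵐ y ∂(μ.restrict Y), dens g y = ∑ j, chartDiff Y π (g i) y (EuclideanSpace.single j 1) *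
      dens (Function.update g i (p j)) y := by
  obtain ⟨C, hπ⟩ := hY.lipschitz
  obtain ⟨huniq, hmeas⟩ := hY.ae_existsUnique (g i)
  -- D is a Borel version of the differential; off the null set N the differential exists, is unique
  -- and equals D.
  set D := hmeas.mk _ with hDdef
  have hDm : Measurable D := hmeas.measurable_mk
  obtain ⟨N, hNsub, hNm, hN0⟩ := exists_measurable_superset_of_null
    (ae_iff.1 (huniq.and hmeas.ae_eq_mk))
  set Z := Y \ N with hZ
  have hZm : MeasurableSet Z := hY.measurableSet.diff hNm
  have hZP : ∀ y ∈ Z, (∃! D, HasChartDiffAt Y π (g i) y D) ∧ chartDiff Y π (g i) y = D y := by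
    intro y hy
    by_contra h'
    exact hy.2 (hNsub h')
  have hZae : ∀ᵐ y ∂(μ.restrict Y), y ∈ Z := by
    filter_upwards [measure_eq_zero_iff_ae_notMem.1 hN0, ae_restrict_mem hY.measurableSet]
      with y h1 h2
    exact ⟨h2, h1⟩
  let K : CompactExhaustion X := default
  choose L hL using fun (m : ℕ) (j : Fin k) => LipLoc.exists_lipschitzOnWith (g j) (K.isCompact m)
  let c : ℕ → (EuclideanSpace ℝ (Fin n) →L[ℝ] ℝ) := TopologicalSpace.denseSeq _
  let r : ℕ → ℝ≥0 := fun q => 1 / ((q : ℝ≥0) + 1)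
  have hr : ∀ q, (0 : ℝ) < r q := fun q => by simp only [r]; positivity
  set θ : X → ℝ := fun y => ((mass T).rnDeriv μ y).toReal
  let B : ℕ → ℝ := fun m => ∏ j ∈ Finset.univ \ {i}, (L m j : ℝ)
  -- The points of K m where the differential is nearly the covector c l; the family is countable,
  -- so a single null set can be discarded for all of it.
  let A : ℕ → ℕ → ℕ → Set X := fun m l q => Z ∩ K m ∩ {y | ‖D y - c l‖ * C < r q}
  have hAm : ∀ m l q, MeasurableSet (A m l q) := fun m l q => by
    refine (hZm.inter (K.isCompact m).measurableSet).inter ?_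
    have : Continuous fun D' : EuclideanSpace ℝ (Fin n) →L[ℝ] ℝ => ‖D' - c l‖ * C := by fun_prop
    exact measurableSet_lt (this.measurable.comp hDm) measurable_const
  have hbound : ∀ m l q, ∀ᵐ y ∂(μ.restrict (A m l q)),
      |dens g y - ∑ j, c l (EuclideanSpace.single j 1) * dens (Function.update g i (p j)) y| ≤
        (r q * B m) * θ y := by
    intro m l q
    have hK := K.isCompact m
    refine ae_abs_le_of_forall_abs_integral_le hac hK (hAm m l q)
      (inter_subset_left.trans inter_subset_right) ?_ fun β hβ => ?_
    · exact (hd1 g _ hK).sub (integrable_finsetSum _ fun j _ => (hd1 _ _ hK).const_mul _)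
    -- The linear combination of densities on the left is the density for u in slot i. Along A this
    -- u has pointwise Lipschitz constant r q, while the other slots keep their constants on K m,
    -- whose product is B m.
    · set u : LipLoc X := g i - ∑ j, c l (EuclideanSpace.single j 1) • p j with hu
      have hux : ∀ x, u x = g i x - ∑ j, c l (EuclideanSpace.single j 1) * p j x := fun x => by
        simp [hu]
      have hβK : ∀ x ∉ K m, β x = 0 := fun x hx => hβ x fun h' => hx h'.1.2
      have hi : ∀ g', Integrable (fun x => β x * dens g' x) μ := fun g' =>
        BorelC.integrable_mul β hK hβK (hd1 g' _ hK)
      have h1 : ∫ x, β x * (dens g x - ∑ j, c l (EuclideanSpace.single j 1) *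
          dens (Function.update g i (p j)) x) ∂μ = T' β (Function.update g i u) := by
        have h2 : ∀ x, β x * (dens g x - ∑ j, c l (EuclideanSpace.single j 1) *
            dens (Function.update g i (p j)) x) = β x * dens g x -
            ∑ j, c l (EuclideanSpace.single j 1) *
              (β x * dens (Function.update g i (p j)) x) := fun x => by
          rw [mul_sub, Finset.mul_sum]
          congr 1
          exact Finset.sum_congr rfl fun j _ => by ring
        simp_rw [h2]
        rw [integral_sub (hi g) (integrable_finsetSum _ fun j _ => (hi _).const_mul _),
          integral_finsetSum _ fun j _ => (hi _).const_mul _]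
        simp_rw [integral_const_mul]
        rw [hu, MultilinearMap.map_update_sub, Function.update_eq_self,
          MultilinearMap.map_update_sum]
        simp_rw [MultilinearMap.map_update_smul, hd2, smul_eq_mul]
      rw [h1]
      have h3 := hE.abs_apply_le_of_eventually hT β (Function.update g i u) (hAm m l q) hβ
        (L := Function.update (L m) i (r q)) fun j y hy => by
          have hsub : A m l q ⊆ K m := fun x hx => hx.1.2
          by_cases hj : j = i
          · subst hj
            simp only [Function.update_self, hux]
            obtain ⟨hex, heq⟩ := hZP y hy.1.1
            have hdiff := hasChartDiffAt_chartDiff hex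
            rw [heq] at hdiff
            have := hdiff.eventually_abs_sub_le (c := c l) hy.1.1.1 hπ hp hy.2
            exact nhdsWithin_mono y (fun x hx => hx.1.1.1) this
          · simp only [Function.update_of_ne hj]
            filter_upwards [self_mem_nhdsWithin] with x hx
            exact (hL m j).dist_le_mul x (hsub hx) y (hsub hy)
      convert h3 using 2
      have h4 : ∀ j, ((Function.update (L m) i (r q) j : ℝ≥0) : ℝ) =
          Function.update (fun j => (L m j : ℝ)) i (r q) j := fun j => by
        by_cases hj : j = i
        · subst hj; simp
        · simp [hj]
      simp_rw [h4]
      rw [Finset.prod_update_of_mem (Finset.mem_univ i)]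
  have hall : ∀ᵐ y ∂(μ.restrict Y), ∀ m l q, y ∈ A m l q →
      |dens g y - ∑ j, c l (EuclideanSpace.single j 1) * dens (Function.update g i (p j)) y| ≤
        (r q * B m) * θ y := by
    refine ae_restrict_of_ae ?_
    refine ae_all_iff.2 fun m => ae_all_iff.2 fun l => ae_all_iff.2 fun q => ?_
    exact (ae_restrict_iff' (hAm m l q)).1 (hbound m l q)
  filter_upwards [hall, hZae] with y hy hyZ
  rw [(hZP y hyZ).2]
  obtain ⟨m, hm⟩ := K.exists_mem y
  set S := ∑ j, |dens (Function.update g i (p j)) y| with hS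
  have hest : ∀ q : ℕ, |dens g y - ∑ j, D y (EuclideanSpace.single j 1) *
      dens (Function.update g i (p j)) y| ≤ (B m * θ y + S) * r q := by
    intro q
    -- The factor C + 1 yields both ‖D y - c l‖ C < r q, placing y in A, and ‖D y - c l‖ ≤ r q,
    -- controlling the return from c l to D y.
    have hpos : (0 : ℝ) < r q / (C + 1) := div_pos (hr q) (by positivity)
    obtain ⟨l, hl⟩ := (TopologicalSpace.denseRange_denseSeq
      (EuclideanSpace ℝ (Fin n) →L[ℝ] ℝ)).exists_dist_lt (D y) hpos
    rw [dist_eq_norm, lt_div_iff₀ (by positivity)] at hl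
    have hn0 := norm_nonneg (D y - c l)
    change ‖D y - c l‖ * (C + 1) < r q at hl
    have hC0 : (0 : ℝ) ≤ C := C.2
    have h1 := hy m l q ⟨⟨hyZ, hm⟩, by
      show ‖D y - c l‖ * C < r q
      linarith⟩
    have h2 : |∑ j, (c l - D y) (EuclideanSpace.single j 1) *
        dens (Function.update g i (p j)) y| ≤ r q * S := by
      refine (Finset.abs_sum_le_sum_abs _ _).trans ?_
      rw [hS, Finset.mul_sum]
      refine Finset.sum_le_sum fun j _ => ?_
      rw [abs_mul]
      refine mul_le_mul_of_nonneg_right ?_ (abs_nonneg _)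
      refine ((c l - D y).le_opNorm _).trans ?_
      rw [PiLp.norm_single, norm_one, mul_one, norm_sub_rev]
      nlinarith
    have h3 : dens g y - ∑ j, D y (EuclideanSpace.single j 1) *
        dens (Function.update g i (p j)) y =
        (dens g y - ∑ j, c l (EuclideanSpace.single j 1) * dens (Function.update g i (p j)) y) +
          ∑ j, (c l - D y) (EuclideanSpace.single j 1) * dens (Function.update g i (p j)) y := by
      simp only [sub_apply, sub_mul, Finset.sum_sub_distrib]
      ring
    rw [h3]
    refine (abs_add_le _ _).trans ((add_le_add h1 h2).trans (le_of_eq ?_))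
    ring
  have hlim : Tendsto (fun q : ℕ => (B m * θ y + S) * (r q : ℝ)) atTop (𝓝 0) := by
    have h1 : Tendsto (fun q : ℕ => (r q : ℝ)) atTop (𝓝 0) := by
      simpa [r] using tendsto_one_div_add_atTop_nhds_zero_nat (𝕜 := ℝ)
    simpa using h1.const_mul (B m * θ y + S)
  exact sub_eq_zero.1 (abs_nonpos_iff.1 (ge_of_tendsto' hlim hest))

end ChainRule

/-! ### The k-vector field and the proof that the extension is a precurrent. -/

section Precurrent

variable {X : Type*} [MetricSpace X] [LocallyCompactSpace X] [SecondCountableTopology X]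
  [MeasurableSpace X] [BorelSpace X] {μ : Measure X} [SigmaFinite μ]
  {k : ℕ} {T : FormFunctional X k} [(mass T).Regular] {T' : MeasFormFunctional X k}
  {n : ℕ} {Y : Set X} {π : X → EuclideanSpace ℝ (Fin n)} {dens : (Fin k → LipLoc X) → X → ℝ}

omit [SigmaFinite μ] in
lemma IsCoordinatePatch.ae_chartDiff_coordinate (hY : IsCoordinatePatch μ Y π)
    {p : Fin n → LipLoc X} (hp : ∀ j, ∀ x ∈ Y, p j x = π x j) :
    ∀ᵐ y ∂(μ.restrict Y), ∀ j l : Fin n,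
      chartDiff Y π (p j) y (EuclideanSpace.single l 1) = if j = l then 1 else 0 := by
  filter_upwards [ae_all_iff.2 fun j => (hY.ae_existsUnique (p j)).1,
    ae_restrict_mem hY.measurableSet] with y hy hyY j l
  rw [chartDiff_eq (hy j) (hasChartDiffAt_proj (hp j) hyY)]
  simp

/-- The chain rule for the densities of `T'`. -/
lemma IsCanonicalExtension.density_eq_sum (hE : IsCanonicalExtension T T')
    (hT : IsMetricCurrent T) (hac : mass T ≪ μ) (hY : IsCoordinatePatch μ Y π)
    (hd1 : ∀ g, ∀ K : Set X, IsCompact K → IntegrableOn (dens g) K μ)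
    (hd2 : ∀ g β, T' β g = ∫ x, β x * dens g x ∂μ)
    {p : Fin n → LipLoc X} (hp : ∀ j, ∀ x ∈ Y, p j x = π x j) (g : Fin k → LipLoc X) :
    ∀ᵐ y ∂(μ.restrict Y), dens g y = ∑ J : Fin k → Fin n,
      (∏ i, chartDiff Y π (g i) y (EuclideanSpace.single (J i) 1)) * dens (fun i => p (J i)) y := by
  have hcoord := hY.ae_chartDiff_coordinate hp
  -- Induction on a set of slots outside of which the arguments are already coordinate functions.
  have key : ∀ s : Finset (Fin k), ∀ g : Fin k → LipLoc X, (∀ i ∉ s, ∃ j, g i = p j) →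
      ∀ᵐ y ∂(μ.restrict Y), dens g y = ∑ J : Fin k → Fin n,
        (∏ i, chartDiff Y π (g i) y (EuclideanSpace.single (J i) 1)) *
          dens (fun i => p (J i)) y := by
    intro s
    induction s using Finset.induction_on with
    | empty =>
      intro g hg
      choose J₀ hJ₀ using fun i => hg i (Finset.notMem_empty i)
      obtain rfl : g = fun i => p (J₀ i) := funext hJ₀
      filter_upwards [hcoord] with y hy
      simp_rw [hy]
      rw [Finset.sum_eq_single J₀]
      · simp
      · intro J _ hJ
        obtain ⟨i, hi⟩ := Function.ne_iff.1 hJ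
        rw [Finset.prod_eq_zero (Finset.mem_univ i) (if_neg fun h => hi h.symm), zero_mul]
      · simp
    | insert i s hi ih =>
      intro g hg
      have h1 : ∀ j, ∀ᵐ y ∂(μ.restrict Y), _ := fun j => ih (Function.update g i (p j)) fun l hl => by
        by_cases hli : l = i
        · subst hli
          exact ⟨j, by simp⟩
        · rw [Function.update_of_ne hli]
          exact hg l (by simp [hli, hl])
      filter_upwards [hcoord, ae_all_iff.2 h1,
        hE.density_eq_sum_update hT hac hY hd1 hd2 hp g i] with y hy hy1 hy2
      rw [hy2]
      simp_rw [hy1, Finset.mul_sum]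
      rw [Finset.sum_comm]
      refine Finset.sum_congr rfl fun J _ => ?_
      -- The coordinate pⱼ in slot i contributes a Kronecker delta, which collapses the sum over j
      -- to j = J i.
      have h2 : ∀ j, ∏ l, chartDiff Y π (Function.update g i (p j) l) y
          (EuclideanSpace.single (J l) 1) = (if j = J i then 1 else 0) *
            ∏ l ∈ Finset.univ \ {i}, chartDiff Y π (g l) y (EuclideanSpace.single (J l) 1) := by
        intro j
        rw [← hy j (J i), ← Finset.prod_update_of_mem (Finset.mem_univ i)]
        refine Finset.prod_congr rfl fun l _ => ?_
        by_cases hl : l = i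
        · subst hl; simp
        · simp [hl]
      simp_rw [h2]
      rw [Finset.sum_eq_single (J i)]
      · rw [if_pos rfl, one_mul, ← mul_assoc]
        congr 1
        rw [← Finset.prod_update_of_mem (Finset.mem_univ i)
          (fun l => chartDiff Y π (g l) y (EuclideanSpace.single (J l) 1)), Function.update_eq_self]
      · intro j _ hj
        simp [hj]
      · simp
  exact key Finset.univ g fun i hi => absurd (Finset.mem_univ i) hi

/-- Both sides are densities of the same functional of β, since T' is alternating; a locally
integrable function that integrates to 0 against all of `B_c(X)` vanishes almost everywhere. -/
lemma IsCanonicalExtension.density_perm (hE : IsCanonicalExtension T T')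
    (hT : IsMetricCurrent T) (hac : mass T ≪ μ)
    (hd1 : ∀ g, ∀ K : Set X, IsCompact K → IntegrableOn (dens g) K μ)
    (hd2 : ∀ g β, T' β g = ∫ x, β x * dens g x ∂μ) (g : Fin k → LipLoc X)
    (σ : Equiv.Perm (Fin k)) :
    ∀ᵐ y ∂μ, dens (fun i => g (σ i)) y = Equiv.Perm.sign σ * dens g y := by
  have h := ae_eq_zero_of_forall_integral_eq_zero hac
    (h := fun y => dens (fun i => g (σ i)) y - Equiv.Perm.sign σ * dens g y)
    (fun K hK => (hd1 _ K hK).sub ((hd1 g K hK).const_mul _)) fun β => by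
      have hi : ∀ g', Integrable (fun x => β x * dens g' x) μ := fun g' =>
        BorelC.integrable_mul β (BorelC.isCompact_tsupport β)
          (fun x hx => image_eq_zero_of_notMem_tsupport hx)
          (hd1 g' _ (BorelC.isCompact_tsupport β))
      have h1 : ∀ x, β x * (dens (fun i => g (σ i)) x - Equiv.Perm.sign σ * dens g x) =
          β x * dens (fun i => g (σ i)) x - Equiv.Perm.sign σ * (β x * dens g x) := fun x => by ring
      simp_rw [h1]
      rw [integral_sub (hi _) ((hi _).const_mul _), integral_const_mul, ← hd2, ← hd2,
        hE.apply_perm hT, sub_self]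
  filter_upwards [h] with y hy
  exact sub_eq_zero.1 hy

/-- The `k`-vector with components `c_J`, divided by `k!`. -/
def kVector (c : (Fin k → Fin n) → ℝ) : ⋀[ℝ]^k (EuclideanSpace ℝ (Fin n)) :=
  ((k.factorial : ℝ)⁻¹) • ∑ J : Fin k → Fin n,
    c J • exteriorPower.ιMulti ℝ k fun i => EuclideanSpace.single (J i) (1 : ℝ)

/-- The pairing of a simple `k`-covector with a `k`-vector given by alternating components. -/
lemma pairingDual_kVector {c : (Fin k → Fin n) → ℝ}
    (hc : ∀ (J : Fin k → Fin n) (σ : Equiv.Perm (Fin k)), c (fun i => J (σ i)) = Equiv.Perm.sign σ * c J)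
    (D : Fin k → Module.Dual ℝ (EuclideanSpace ℝ (Fin n))) :
    exteriorPower.pairingDual ℝ (EuclideanSpace ℝ (Fin n)) k (exteriorPower.ιMulti ℝ k D)
      (kVector c) = ∑ J : Fin k → Fin n, (∏ i, D i (EuclideanSpace.single (J i) 1)) * c J := by
  set F : (Fin k → Fin n) → ℝ := fun J => (∏ i, D i (EuclideanSpace.single (J i) 1)) * c J with hF
  -- By the alternation of c, the sign in the determinant expansion is absorbed into c. After
  -- summing over J each of the k! permutations gives the same total, which cancels the
  -- normalization.
  have h1 : ∀ J, c J * Matrix.det (n := Fin k)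
      (.of fun i j => D j (EuclideanSpace.single (J i) (1 : ℝ))) =
      ∑ σ : Equiv.Perm (Fin k), F (fun i => J (σ i)) := by
    intro J
    rw [Matrix.det_apply', Finset.mul_sum]
    refine Finset.sum_congr rfl fun σ _ => ?_
    rw [hF]
    simp only [hc J σ, Matrix.of_apply]
    ring
  have h2 : ∀ σ : Equiv.Perm (Fin k), ∑ J : Fin k → Fin n, F (fun i => J (σ i)) = ∑ J, F J :=
    fun σ => Equiv.sum_comp (Equiv.arrowCongr σ.symm (Equiv.refl (Fin n))) F
  rw [kVector, map_smul, map_sum]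
  simp_rw [map_smul, exteriorPower.pairingDual_ιMulti_ιMulti, smul_eq_mul, h1]
  rw [Finset.sum_comm]
  simp_rw [h2]
  rw [Finset.sum_const, Finset.card_univ, Fintype.card_perm, Fintype.card_fin, nsmul_eq_mul,
    inv_mul_cancel_left₀ (by exact_mod_cast k.factorial_ne_zero)]

/-- The canonical extension of a metric current whose mass is absolutely continuous with respect to
`μ` is a precurrent on every coordinate patch. -/
lemma IsCanonicalExtension.isPrecurrentOn (hE : IsCanonicalExtension T T')
    (hT : IsMetricCurrent T) (hac : mass T ≪ μ) (hY : IsCoordinatePatch μ Y π) :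
    IsPrecurrentOn μ Y π (MeasFormFunctional.restrict T' hY.measurableSet) := by
  obtain ⟨dens, hd1, hd2⟩ := hE.exists_density hT hac
  obtain ⟨C, hπ⟩ := hY.lipschitz
  obtain ⟨p, hp⟩ := exists_coordinates hπ
  have hv : ∀ g : Fin k → LipLoc X, ∀ᵐ y ∂(μ.restrict Y),
      wedgePairing Y π g y (kVector fun J => dens (fun i => p (J i)) y) = dens g y := by
    intro g
    -- Each identity holds almost everywhere; there are finitely many J and σ, so one null set is
    -- enough.
    have hperm : ∀ᵐ y ∂(μ.restrict Y), ∀ (J : Fin k → Fin n) (σ : Equiv.Perm (Fin k)),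
        dens (fun i => p (J (σ i))) y = Equiv.Perm.sign σ * dens (fun i => p (J i)) y :=
      ae_restrict_of_ae (ae_all_iff.2 fun J => ae_all_iff.2 fun σ =>
        hE.density_perm hT hac hd1 hd2 (fun i => p (J i)) σ)
    filter_upwards [hperm, hE.density_eq_sum hT hac hY hd1 hd2 hp g] with y hy1 hy2
    rw [hy2, wedgePairing, pairingDual_kVector hy1]
    rfl
  refine ⟨fun y => kVector fun J => dens (fun i => p (J i)) y, fun ℓ => ?_, fun β g => ?_⟩
  · intro x
    obtain ⟨K, hK, hxK⟩ := exists_compact_mem_nhds x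
    refine ⟨K, hxK, ?_⟩
    simp only [kVector, map_smul, map_sum, smul_eq_mul]
    refine Integrable.const_mul (integrable_finsetSum _ fun J _ => ?_) _
    exact ((hd1 _ K hK).mono_measure Measure.restrict_le_self).mul_const _
  · have hi : Integrable (fun x => β x * dens g x) μ :=
      BorelC.integrable_mul β (BorelC.isCompact_tsupport β)
        (fun x hx => image_eq_zero_of_notMem_tsupport hx)
        (hd1 g _ (BorelC.isCompact_tsupport β))
    have heq : (fun y => β y * wedgePairing Y π g y (kVector fun J => dens (fun i => p (J i)) y))
        =ᵐ[μ.restrict Y] fun y => β y * dens g y := by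
      filter_upwards [hv g] with y hy
      rw [hy]
    refine ⟨ae_all_iff.2 fun i => (hY.ae_existsUnique (g i)).1,
      hi.integrableOn.congr heq.symm, ?_⟩
    rw [integral_congr_ae heq, ← integral_indicator hY.measurableSet]
    show T' (BorelC.indicator hY.measurableSet β) g = _
    rw [hd2]
    refine integral_congr_ae (Eventually.of_forall fun x => ?_)
    by_cases hx : x ∈ Y <;> simp [hx]

end Precurrent

end

end MetricCurrents

theorem theorem1p3 {X : Type*} [MetricSpace X] [TopologicalSpace.SeparableSpace X]
    [LocallyCompactSpace X] [MeasurableSpace X] [BorelSpace X]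
    (μ : MeasureTheory.Measure X) [MeasureTheory.SigmaFinite μ]
    (hX : MetricCurrents.AdmitsDifferentiableStructure μ)
    (k : ℕ) (T : MetricCurrents.FormFunctional X k) (hT : MetricCurrents.IsMetricCurrent T)
    (hfin : MetricCurrents.HasLocallyFiniteMass T) (hac : MetricCurrents.mass T ≪ μ) :
    (∃! T' : MetricCurrents.MeasFormFunctional X k, MetricCurrents.IsCanonicalExtension T T') ∧
    ∀ T' : MetricCurrents.MeasFormFunctional X k, MetricCurrents.IsCanonicalExtension T T' →
      MetricCurrents.IsPrecurrent μ T' := by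
  have := UniformSpace.secondCountable_of_separable X
  -- On a locally compact, second countable metric space, finiteness on compact sets makes the mass
  -- regular, which is the instance assumed throughout the construction.
  have : MeasureTheory.IsFiniteMeasureOnCompacts (MetricCurrents.mass T) :=
    ⟨fun K hK => hfin K (by rwa [hK.isClosed.closure_eq])⟩
  refine ⟨?_, fun T' hE n Y π hY => hE.isPrecurrentOn hT hac hY⟩
  obtain ⟨T', hE⟩ := hT.exists_canonicalExtension
  exact ⟨T', hE, fun T'' hE' => hE'.unique hE⟩
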